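/- **Setting.** Let $A$ be a finite-dimensional real algebra with unit, not necessarily associative, of real dimension greater than $1$, which is alternative, i.e. $(x,y,z)\mapsto (xy)z-x(yz)$ is alternating. Let $x\mapsto x^c$ be an $\mathbb{R}$-linear map on $A$ with $(x^c)^c=x$, $(xy)^c=y^cx^c$ and $r^c=r$ for $r\in\mathbb{R}$, where $\mathbb{R}$ is identified with $\mathbb{R}\cdot 1\subseteq A$. Give $A$ the topology of any vector space norm. Put $t(x)=x+x^c$, $n(x)=xx^c$, $$Q_A=\mathbb{R}\cup\{x\in A: t(x)\in\mathbb{R},\ n(x)\in\mathbb{R},\ t(x)^2-4n(x)<0\},\qquad \mathbb{S}_A=\{J\in Q_A: J^2=-1\}.$$ For $J\in\mathbb{S}_A$ let $\mathbb{C}_J=\{r+sJ: r,s\in\mathbb{R}\}$ and $\phi_J:\mathbb{C}\to\mathbb{C}_J$, $\phi_J(r+si)=r+sJ$. For $x\in Q_A\setminus\{0\}$ one has $x^{-1}=n(x)^{-1}x^c$. Let $A_{\mathbb{C}}=A+A\,\mathbf{i}$ be the complexification of $A$, with product $(x+y\mathbf{i})(x'+y'\mathbf{i})=(xx'-yy')+(xy'+yx')\mathbf{i}$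 and conjugation $\overline{x+y\mathbf{i}}=x-y\mathbf{i}$. For $D\subseteq\mathbb{C}$ invariant under complex conjugation, let $\Omega_D=\{r+sJ: J\in\mathbb{S}_A,\ r+si\in D\}$. A stem function on $D$ is a map $F=F_1+F_2\mathbf{i}:D\to A_{\mathbb{C}}$ with $F(\bar z)=\overline{F(z)}$; it induces the (well-defined) left slice function $\mathcal{I}(F):\Omega_D\to A$, $\mathcal{I}(F)(r+sJ)=F_1(r+si)+J\,F_2(r+si)$. The slice product is $\mathcal{I}(F)\cdot\mathcal{I}(G)=\mathcal{I}(FG)$. If $D$ is open and $F$ is of class $C^1$ on $D$, then $f=\mathcal{I}(F)$ is called left slice regular on $\Omega_D$ if $\partial f/\partial x^c:=\mathcal{I}(\partial F/\partial\bar z)=0$ on $\Omega_D$, where $\partial F/\partial\bar z=\frac12\left(\partial F/\partial r+(\partial F/\partial s)\,\mathbf{i}\right)$ for $z=r+si$. For $y\in Q_A$ the Cauchy kernel is the slice function $$C_y=\mathcal{I}\big((z^2-z\,t(y)+n(y))^{-1}(y^c-z)\big),$$ defined where $x^2-x\,t(y)+n(y)\ne0$. **Statement.** Let $D\subseteq\mathbb{C}$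 be a bounded open set, not necessarily connected, invariant under complex conjugation, let $J\in\mathbb{S}_A$, and let $D_J=\Omega_D\cap\mathbb{C}_J$. Assume that the boundary $\partial D_J$ of $D_J$ in $\mathbb{C}_J$ is piecewise $C^1$ and positively oriented, in the following sense: there are finitely many closed piecewise $C^1$ curves $\gamma_k:[a_k,b_k]\to\mathbb{C}$ such that the curves $\alpha_k=\phi_J\circ\gamma_k$ together have trace $\partial D_J$, and such that the winding numbers of the $\gamma_k$ about $z$ add up to $1$ for every $z\in D$ and to $0$ for every $z\notin\overline{D}$ (for instance, a single counterclockwise oriented Jordan curve bounding $D$). Let $F$ be a stem function on $D$ of class $C^1(\overline{D};A_{\mathbb{C}})$, i.e. $F$ is of class $C^1$ on $D$, and $F$ and its first partial derivatives extend continuously to $\overline{D}$. Let $f=\mathcal{I}(F)$, with values on $\partial D_J$ given by the continuous extension of $F$. If $f$ is left slice regular on $\Omega_D$, then for every $x\in\Omega_D$ $$f(x)=\frac1{2\pi}\int_{\partial D_J}\big[C_y\cdot(J^{-1}\,dy\,f(y))\big](x):=\frac1{2\pi}\sum_k\int_{a_k}^{b_k}\Big[C_{\alpha_k(t)}\cdot\big(J^{-1}\alpha_k'(t)\,f(\alpha_k(t))\big)\Big](x)\,dt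 ,$$ where all the integrals exist. Here the slice product is taken with respect to the variable $x$, between the Cauchy kernel $C_y$ and the constant function with value $J^{-1}\alpha_k'(t)\,f(\alpha_k(t))$. -/

import Mathlib

open scoped ComplexConjugate

noncomputable section

namespace SliceRegular

/-- A not necessarily associative unital ring whose additive group carries a norm.  The norm is only
a norm of the underlying vector space: no compatibility with the multiplication is required. -/
class NormedSpaceNonAssocRing (A : Type*) extends NormedAddCommGroup A, NonAssocRing A

/-- The algebra is alternative: the associator `(x y) z - x (y z)` is alternating, i.e. it vanishes
as soon as two of its arguments coincide. -/
class IsAlternative (A : Type*) [NonAssocRing A] : Prop where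
  left_alternative : ∀ x y : A, associator x x y = 0
  right_alternative : ∀ x y : A, associator x y y = 0
  flexible : ∀ x y : A, associator x y x = 0

section Cone

variable {A : Type*} [NormedSpaceNonAssocRing A] [NormedSpace ℝ A] [StarRing A]

/-- `t(x) = x + x^c`. -/
def trace (x : A) : A := x + star x

/-- `n(x) = x x^c`. -/
def sqNorm (x : A) : A := x * star x

variable (A) in
/-- The quadratic cone `Q_A`; real numbers `r` are identified with `r • 1`. -/
def quadraticCone : Set A :=
  {x | ∃ r : ℝ, x = r • (1 : A)} ∪
    {x | ∃ t n : ℝ, trace x = t • (1 : A) ∧ sqNorm x = n • (1 : A) ∧ t ^ 2 - 4 * n < 0}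

variable (A) in
/-- The set `S_A` of square roots of `-1` in the quadratic cone. -/
def imagUnits : Set A := {J | J ∈ quadraticCone A ∧ J * J = -1}

open Classical in
/-- The real number `r` with `a = r • 1`, for an element `a` of `ℝ ⊆ A` (and `0` for other `a`). -/
def toReal (a : A) : ℝ := if h : ∃ r : ℝ, a = r • (1 : A) then h.choose else 0

/-- The inverse `x⁻¹ = n(x)⁻¹ x^c` of a nonzero element of the quadratic cone. -/
def coneInv (x : A) : A := (toReal (sqNorm x))⁻¹ • star x

/-- The map `φ_J : ℂ → ℂ_J`, `r + s i ↦ r + s J`. -/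
def phi (J : A) (z : ℂ) : A := z.re • (1 : A) + z.im • J

/-- The plane `ℂ_J = ⟨1, J⟩`. -/
def slicePlane (J : A) : Submodule ℝ A := Submodule.span ℝ {1, J}

variable (A) in
/-- The circular set `Ω_D = {r + s J : r + s i ∈ D, J ∈ S_A}`. -/
def circularSet (D : Set ℂ) : Set A := {x | ∃ z ∈ D, ∃ J ∈ imagUnits A, x = phi J z}

/-- The boundary of `D_J = Ω_D ∩ ℂ_J` relative to the plane `ℂ_J`, as a subset of `A`. -/
def sliceBoundary (D : Set ℂ) (J : A) : Set A :=
  (fun y : slicePlane J => (y : A)) ''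
    frontier {y : slicePlane J | (y : A) ∈ circularSet A D}

end Cone

/-- The complexification `A_ℂ = A + A i`; the pair `(x, y)` stands for `x + y i`. -/
def Complexification (A : Type*) : Type _ := A × A

namespace Complexification

variable {A : Type*} [NormedSpaceNonAssocRing A]

instance : NormedAddCommGroup (Complexification A) := inferInstanceAs (NormedAddCommGroup (A × A))

instance [NormedSpace ℝ A] : NormedSpace ℝ (Complexification A) :=
  inferInstanceAs (NormedSpace ℝ (A × A))

/-- `x + y i` -/
def mk (x y : A) : Complexification A := (x, y)

/-- `x + y i ↦ x` -/
def fstPart (v : Complexification A) : A := v.1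

/-- `x + y i ↦ y` -/
def sndPart (v : Complexification A) : A := v.2

/-- `(x + y i)(x' + y' i) = (x x' - y y') + (x y' + y x') i`. -/
instance : Mul (Complexification A) :=
  ⟨fun v w => mk (fstPart v * fstPart w - sndPart v * sndPart w)
    (fstPart v * sndPart w + sndPart v * fstPart w)⟩

/-- `(r + s i)(x + y i) = (r x - s y) + (r y + s x) i`. -/
instance [NormedSpace ℝ A] : SMul ℂ (Complexification A) :=
  ⟨fun z v => mk (z.re • fstPart v - z.im • sndPart v) (z.re • sndPart v + z.im • fstPart v)⟩

/-- The complex conjugation `x + y i ↦ x - y i`. -/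
def conjugate (v : Complexification A) : Complexification A := mk (fstPart v) (-sndPart v)

/-- The inclusion of `A` in `A_ℂ`. -/
def ofA (a : A) : Complexification A := mk a 0

/-- The inclusion of `ℂ` in `A_ℂ`. -/
def ofComplex [NormedSpace ℝ A] (z : ℂ) : Complexification A := mk (z.re • 1) (z.im • 1)

/-- The imaginary unit of `A_ℂ`. -/
def I : Complexification A := mk 0 1

end Complexification

open Complexification

section SliceFunctions

variable {A : Type*} [NormedSpaceNonAssocRing A] [NormedSpace ℝ A] [StarRing A]

/-- `F` is a stem function on `D`: `F(z̄)` is the complex conjugate of `F(z)` for `z ∈ D`. -/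
def IsStem (D : Set ℂ) (F : ℂ → Complexification A) : Prop :=
  ∀ z ∈ D, F (conj z) = conjugate (F z)

open Classical in
/-- The left slice function `𝓘(F)`: `𝓘(F)(r + s J) = F₁(r + s i) + J F₂(r + s i)`, computed from any
representation `x = r + s J` with `J ∈ S_A` (and `0` off the cone).  Where `F` is a stem function the
value does not depend on the representation, see `sliceFunction_phi`. -/
def sliceFunction (F : ℂ → Complexification A) (x : A) : A :=
  if h : ∃ p : ℂ × A, p.2 ∈ imagUnits A ∧ x = phi p.2 p.1 then
    fstPart (F h.choose.1) + h.choose.2 * sndPart (F h.choose.1)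
  else 0

/-- The slice product `𝓘(F) · 𝓘(G) = 𝓘(F G)` of the slice functions induced by the stem functions
`F` and `G`. -/
def sliceProduct (F G : ℂ → Complexification A) : A → A := sliceFunction (fun z => F z * G z)

/-- `∂F/∂z̄ = (∂F/∂r + (∂F/∂s) i) / 2`. -/
def dbar (F : ℂ → Complexification A) (z : ℂ) : Complexification A :=
  (1 / 2 : ℝ) • (fderiv ℝ F z 1 + fderiv ℝ F z Complex.I * Complexification.I)

/-- The slice function `f = 𝓘(F)` is left slice regular on `Ω_D`: `F` is of class `C¹` on `D` and
`∂f/∂x^c = 𝓘(∂F/∂z̄)` vanishes on `Ω_D`. -/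
def IsSliceRegular (D : Set ℂ) (F : ℂ → Complexification A) : Prop :=
  ContDiffOn ℝ 1 F D ∧ ∀ x ∈ circularSet A D, sliceFunction (dbar F) x = 0

/-- `F ∈ C¹(D̄)` for an open set `D`: `F` is continuous on `D̄`, of class `C¹` on `D`, and its
derivative extends continuously to `D̄`. -/
def IsC1OnClosure (D : Set ℂ) (F : ℂ → Complexification A) : Prop :=
  ContinuousOn F (closure D) ∧
    ∃ F' : ℂ → (ℂ →L[ℝ] Complexification A), ContinuousOn F' (closure D) ∧
      ∀ z ∈ D, HasFDerivAt F (F' z) z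

/-- The stem function `z ↦ (z² - z t(y) + n(y))⁻¹ (y^c - z)` that induces the Cauchy kernel `C_y`. -/
def cauchyKernelStem (y : A) (z : ℂ) : Complexification A :=
  (z ^ 2 - z * (toReal (trace y) : ℂ) + (toReal (sqNorm y) : ℂ))⁻¹ • (ofA (star y) - ofComplex z)

/-- `[C_y · a](x)`: the slice product, in the variable `x`, of the Cauchy kernel `C_y` and of the
constant function `a` (which is induced by the constant stem function `a`). -/
def cauchyKernelMulConst (y a x : A) : A :=
  sliceProduct (cauchyKernelStem y) (fun _ => ofA a) x

/-- For a curve `α` in `ℂ_J`, the integrand `[C_{α(t)} · (J⁻¹ α'(t) f(α(t)))](x)` of the line integral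
`∫ [C_y · (J⁻¹ dy f(y))](x)` along `α`. -/
def cauchyIntegrand (J : A) (f : A → A) (α : ℝ → A) (x : A) (t : ℝ) : A :=
  cauchyKernelMulConst (α t) (coneInv J * deriv α t * f (α t)) x

end SliceFunctions

section Curves

/-- `γ` restricted to `[a, b]` is a closed piecewise `C¹` curve in the plane. -/
structure IsClosedPiecewiseC1 (γ : ℝ → ℂ) (a b : ℝ) : Prop where
  lt : a < b
  closed : γ a = γ b
  continuousOn : ContinuousOn γ (Set.Icc a b)
  pieces : ∃ (n : ℕ) (t : ℕ → ℝ), t 0 = a ∧ t n = b ∧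
    ∀ i < n, t i < t (i + 1) ∧ ContDiffOn ℝ 1 γ (Set.Icc (t i) (t (i + 1)))

/-- The winding number `(1 / 2πi) ∫_γ dζ / (ζ - z)` of a closed piecewise `C¹` curve. -/
def windingNumber (γ : ℝ → ℂ) (a b : ℝ) (z : ℂ) : ℂ :=
  (2 * Real.pi * Complex.I)⁻¹ * ∫ t in a..b, deriv γ t / (γ t - z)

/-- The curves `φ_J ∘ γ₁, …, φ_J ∘ γ_m` are a piecewise `C¹` parametrization of the positively
oriented boundary of `D_J` in `ℂ_J`: they are closed and piecewise `C¹`, together they trace out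
`∂D_J`, and the cycle `γ₁ + ⋯ + γ_m` bounds `D`, i.e. it winds once about each point of `D` and does
not wind about the points outside `D̄`.  A counterclockwise oriented Jordan curve that bounds `D` is
the case `m = 1`. -/
structure IsOrientedBoundary {A : Type*} [NormedSpaceNonAssocRing A] [NormedSpace ℝ A] [StarRing A]
    (J : A) (D : Set ℂ) {m : ℕ} (γ : Fin m → ℝ → ℂ) (a b : Fin m → ℝ) : Prop where
  isClosedPiecewiseC1 : ∀ k, IsClosedPiecewiseC1 (γ k) (a k) (b k)
  trace_eq : ⋃ k, (fun t => phi J (γ k t)) '' Set.Icc (a k) (b k) = sliceBoundary D J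
  winding_inside : ∀ z ∈ D, ∑ k, windingNumber (γ k) (a k) (b k) z = 1
  winding_outside : ∀ z ∉ closure D, ∑ k, windingNumber (γ k) (a k) (b k) z = 0

end Curves

section WellDefined

set_option linter.unusedSectionVars false

variable {A : Type*} [NormedSpaceNonAssocRing A] [NormedSpace ℝ A] [IsScalarTower ℝ A A]
  [SMulCommClass ℝ A A] [StarRing A] [StarModule ℝ A] [Nontrivial A]

theorem smul_one_injective {r s : ℝ} (h : r • (1 : A) = s • (1 : A)) : r = s :=
  smul_left_injective ℝ (one_ne_zero : (1 : A) ≠ 0) h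

theorem toReal_smul_one (r : ℝ) : toReal (r • (1 : A)) = r := by
  have h : ∃ s : ℝ, r • (1 : A) = s • (1 : A) := ⟨r, rfl⟩
  unfold toReal
  rw [dif_pos h]
  exact (smul_one_injective h.choose_spec).symm

theorem star_smul_one (r : ℝ) : star (r • (1 : A)) = r • (1 : A) := by
  rw [star_smul, star_one, star_trivial]

theorem not_real_of_mem {J : A} (hJ : J ∈ imagUnits A) (r : ℝ) : J ≠ r • (1 : A) := by
  intro h
  have h2 := hJ.2
  have h3 : (r * r) • (1 : A) = (-1 : ℝ) • (1 : A) := by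
    rw [h, smul_mul_assoc, one_mul, smul_smul] at h2
    rw [h2, neg_one_smul]
  have := smul_one_injective h3
  nlinarith [mul_self_nonneg r]

theorem star_of_mem {J : A} (hJ : J ∈ imagUnits A) : star J = -J := by
  rcases hJ.1 with ⟨r, hr⟩ | ⟨t, n, ht, hn, -⟩
  · exact absurd hr (not_real_of_mem hJ r)
  · have hs : star J = t • (1 : A) - J := by rw [← ht, trace]; abel
    rw [sqNorm, hs, mul_sub, hJ.2, mul_smul_comm, mul_one] at hn
    by_cases h0 : t = 0
    · rw [hs, h0, zero_smul, zero_sub]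
    · have h1 : t • J = (n - 1) • (1 : A) := by
        rw [sub_smul, one_smul, ← hn]; abel
      have h2 : J = (t⁻¹ * (n - 1)) • (1 : A) := by
        rw [mul_smul, ← h1, smul_smul, inv_mul_cancel₀ h0, one_smul]
      exact absurd h2 (not_real_of_mem hJ _)

/-- Two representations `r + s J` of the same point agree up to `(s, J) ↦ (-s, -J)`, or `s = 0`. -/
theorem phi_eq_phi {J K : A} (hJ : J ∈ imagUnits A) (hK : K ∈ imagUnits A) {z w : ℂ}
    (h : phi J z = phi K w) :
    (w = z ∧ (K = J ∨ z.im = 0)) ∨ (w = conj z ∧ K = -J) := by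
  have hsJ : star (phi J z) = z.re • (1 : A) - z.im • J := by
    rw [phi, star_add, star_smul_one, star_smul, star_trivial, star_of_mem hJ, smul_neg,
      sub_eq_add_neg]
  have hsK : star (phi K w) = w.re • (1 : A) - w.im • K := by
    rw [phi, star_add, star_smul_one, star_smul, star_trivial, star_of_mem hK, smul_neg,
      sub_eq_add_neg]
  have hs : z.re • (1 : A) - z.im • J = w.re • (1 : A) - w.im • K := by rw [← hsJ, ← hsK, h]
  have hp : z.re • (1 : A) + z.im • J = w.re • (1 : A) + w.im • K := h
  have hre : z.re = w.re := by
    have h2 : (z.re + z.re) • (1 : A) = (w.re + w.re) • (1 : A) := by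
      have := congrArg₂ (· + ·) hp hs
      simp only [add_smul]
      calc _ = z.re • (1 : A) + z.im • J + (z.re • (1 : A) - z.im • J) := by abel
        _ = w.re • (1 : A) + w.im • K + (w.re • (1 : A) - w.im • K) := this
        _ = _ := by abel
    have := smul_one_injective h2
    linarith
  have him : z.im • J = w.im • K := by
    rw [hre] at hp
    exact add_left_cancel hp
  have hsq : z.im * z.im = w.im * w.im := by
    have h2 : (z.im • J) * (z.im • J) = (w.im • K) * (w.im • K) := by rw [him]
    rw [smul_mul_assoc, mul_smul_comm, hJ.2, smul_mul_assoc, mul_smul_comm, hK.2, smul_smul,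
      smul_smul, smul_neg, smul_neg, neg_inj] at h2
    exact smul_one_injective h2
  rcases mul_self_eq_mul_self_iff.mp hsq with h1 | h1
  · left
    refine ⟨Complex.ext hre.symm h1.symm, ?_⟩
    by_cases h0 : z.im = 0
    · exact Or.inr h0
    · left
      rw [← h1] at him
      exact (smul_right_injective A h0 him).symm
  · by_cases h0 : z.im = 0
    · left
      have hw : w.im = 0 := by rw [h0] at h1; linarith
      exact ⟨Complex.ext hre.symm (by rw [hw, h0]), Or.inr h0⟩
    · right
      refine ⟨Complex.ext (by simp [hre]) (by simp [h1]), ?_⟩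
      have hw : w.im = -z.im := by linarith
      rw [hw, neg_smul, ← smul_neg] at him
      have := smul_right_injective A h0 him
      rw [this, neg_neg]

/-- The slice function induced by a stem function is well defined. -/
theorem sliceFunction_phi {E : Set ℂ} {F : ℂ → Complexification A} (hF : IsStem E F) {z : ℂ}
    (hz : z ∈ E) {J : A} (hJ : J ∈ imagUnits A) :
    sliceFunction F (phi J z) = fstPart (F z) + J * sndPart (F z) := by
  have h : ∃ p : ℂ × A, p.2 ∈ imagUnits A ∧ phi J z = phi p.2 p.1 := ⟨(z, J), hJ, rfl⟩
  unfold sliceFunction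
  rw [dif_pos h]
  obtain ⟨hK, he⟩ := h.choose_spec
  generalize h.choose = p at hK he
  obtain ⟨w, K⟩ := p
  simp only at hK he ⊢
  rcases phi_eq_phi hJ hK he with ⟨rfl, rfl | h0⟩ | ⟨rfl, rfl⟩
  · rfl
  · have h1 : conj w = w := Complex.conj_eq_iff_im.mpr h0
    have h2 := hF w hz
    rw [h1] at h2
    have h3 : sndPart (F w) = -sndPart (F w) := congrArg sndPart h2
    have h4 : sndPart (F w) = 0 := by
      have h5 : (2 : ℝ) • sndPart (F w) = 0 := by
        rw [two_smul]; nth_rewrite 1 [h3]; exact neg_add_cancel _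
      exact (smul_eq_zero.mp h5).resolve_left two_ne_zero
    rw [h4, mul_zero, mul_zero]
  · rw [hF z hz]
    show fstPart (F z) + -J * -sndPart (F z) = _
    rw [neg_mul_neg]

end WellDefined

end SliceRegular

end

open SliceRegular

namespace SliceRegular

open MeasureTheory Set Metric Filter Topology
open scoped NNReal ENNReal

/-! The Cauchy kernel splits into two ordinary ones. For `y = φ_J(ζ)` its denominator at `z` is `(z
- ζ)(z - ζ̄)`, so partial fractions turn the integrand at `x = φ_K(z)` into `½(V + W) + K(J(½(W -
V)))`, where `V` and `W` are the integrands of Cauchy's formula on `ℂ_J` at `z` and at `z̄`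
(`cauchyKernelMulConst_phi_phi`). Their integrals are `2π(F₁(z) ± J F₂(z))`, and `J(Ju) = -u`
reassembles `F₁(z) + K F₂(z)`.

Left alternativity replaces associativity: `J(Ju) = -u` makes `A` a complex vector space in which
`i` acts as left multiplication by `J`. Slice regularity makes `F₁ + J F₂` holomorphic for this
structure, and the complex linear functionals `ℓ(a) - iℓ(Ja)` reduce Cauchy's formula to scalar
functions.

The scalar theorem is needed for a cycle lying on the boundary itself, which is not pushed into `D`.
Instead `g` is averaged over discs of radius `ε`: Fubini and the winding numbers give `∑ ∫
(∫_{B(γ,ε)} g) dγ = ∫_D ∮_{C(z,ε)} g`. The left side is `πε² ∑ ∫ g dγ` up to `O(ε² · osc)`, where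
`osc` is the oscillation of `g` at scale `ε`. On the right the circle integral vanishes unless `z`
is within `2ε` of the boundary, a region of area `O(ε)`, where it is `O(ε · osc)`. Dividing by `ε²`
and letting `ε → 0` gives Cauchy's theorem (`sum_integral_eq_zero`); applied to a difference
quotient it gives Cauchy's formula. -/

/-! ### Piecewise `C¹` curves are Lipschitz -/

theorem lipschitzOnWith_Icc_union {f : ℝ → ℂ} {C : ℝ≥0} {a c b : ℝ}
    (h1 : LipschitzOnWith C f (Icc a c)) (h2 : LipschitzOnWith C f (Icc c b)) :
    LipschitzOnWith C f (Icc a b) := by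
  have key : ∀ x ∈ Icc a b, ∀ y ∈ Icc a b, x ≤ y → dist (f x) (f y) ≤ C * dist x y := by
    intro x hx y hy hxy
    by_cases hy' : y ≤ c
    · exact h1.dist_le_mul x ⟨hx.1, hxy.trans hy'⟩ y ⟨hy.1, hy'⟩
    by_cases hx' : c ≤ x
    · exact h2.dist_le_mul x ⟨hx', hx.2⟩ y ⟨hx'.trans hxy, hy.2⟩
    push Not at hx' hy'
    calc dist (f x) (f y) ≤ dist (f x) (f c) + dist (f c) (f y) := dist_triangle _ _ _
      _ ≤ C * dist x c + C * dist c y :=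
        add_le_add (h1.dist_le_mul x ⟨hx.1, hx'.le⟩ c ⟨hx.1.trans hx'.le, le_rfl⟩)
          (h2.dist_le_mul c ⟨le_rfl, hy'.le.trans hy.2⟩ y ⟨hy'.le, hy.2⟩)
      _ = C * dist x y := by
        rw [Real.dist_eq, Real.dist_eq, Real.dist_eq, abs_of_nonpos (sub_nonpos.2 hx'.le),
          abs_of_nonpos (sub_nonpos.2 hy'.le), abs_of_nonpos (sub_nonpos.2 hxy)]
        ring
  refine LipschitzOnWith.of_dist_le_mul fun x hx y hy => ?_
  rcases le_total x y with h | h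
  · exact key x hx y hy h
  · rw [dist_comm, dist_comm x]
    exact key y hy x hx h

/-- Each `C¹` piece is Lipschitz by compactness, and finitely many pieces glue. The scalar Cauchy
theory below uses only this Lipschitz bound. -/
theorem IsClosedPiecewiseC1.exists_lipschitzOnWith {γ : ℝ → ℂ} {a b : ℝ}
    (h : IsClosedPiecewiseC1 γ a b) : ∃ C : ℝ≥0, LipschitzOnWith C γ (Icc a b) := by
  obtain ⟨n, t, h0, hn, hp⟩ := h.pieces
  have key : ∀ i ≤ n, ∃ C : ℝ≥0, LipschitzOnWith C γ (Icc (t 0) (t i)) := by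
    intro i
    induction i with
    | zero => exact fun _ => ⟨0, by simp⟩
    | succ i ih =>
      intro hi
      obtain ⟨C₁, h₁⟩ := ih (by omega)
      obtain ⟨C₂, h₂⟩ := LocallyLipschitzOn.exists_lipschitzOnWith_of_compact isCompact_Icc
        ((hp i (by omega)).2.locallyLipschitzOn (convex_Icc _ _))
      exact ⟨max C₁ C₂, lipschitzOnWith_Icc_union (h₁.weaken (le_max_left _ _))
        (h₂.weaken (le_max_right _ _))⟩
  have := key n le_rfl
  rwa [h0, hn] at this

/-! ### Area integrals of the Cauchy kernel -/

/-- In polar coordinates the area element `r dr` cancels the singularity `1/r`. -/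
theorem integrableOn_inv_norm_ball :
    IntegrableOn (fun z : ℂ => ‖z‖⁻¹) (ball 0 1) := by
  refine (integrableOn_fun_norm_addHaar volume (f := fun r : ℝ => r⁻¹)).2 ?_
  have h : IntegrableOn (fun _ : ℝ => (1 : ℝ)) (Ioo 0 1) := by
    simp [integrableOn_const_iff]
  refine h.congr_fun (fun y hy => ?_) measurableSet_Ioo
  have := hy.1.ne'
  simp [Complex.finrank_real_complex, this]

/-- The Cauchy kernel is integrable on sets of finite area, uniformly in the singularity. -/
theorem exists_setIntegral_inv_norm_sub_le {S : Set ℂ} (hS : volume S ≠ ∞) :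
    ∃ K : ℝ, ∀ c : ℂ, IntegrableOn (fun z => ‖c - z‖⁻¹) S ∧ ∫ z in S, ‖c - z‖⁻¹ ≤ K := by
  set g : ℂ → ℝ := (ball 0 1).indicator fun z => ‖z‖⁻¹ with hg
  have hgi : Integrable g := integrableOn_inv_norm_ball.integrable_indicator measurableSet_ball
  have hg0 : ∀ z, 0 ≤ g z := fun z => indicator_nonneg (fun _ _ => by positivity) z
  have hgc : ∀ c, Integrable fun z => g (c - z) := fun c => hgi.comp_sub_left c
  have hb : ∀ c z : ℂ, ‖c - z‖⁻¹ ≤ 1 + g (c - z) := by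
    intro c z
    by_cases h : c - z ∈ ball (0 : ℂ) 1
    · simp [hg, indicator_of_mem h]
    · have : 1 ≤ ‖c - z‖ := by simpa using h
      have := hg0 (c - z)
      have := inv_le_one_of_one_le₀ ‹1 ≤ ‖c - z‖›
      linarith
  have hi1 : IntegrableOn (fun _ : ℂ => (1 : ℝ)) S := integrableOn_const hS
  have hi2 : ∀ c, IntegrableOn (fun z => 1 + g (c - z)) S := fun c => hi1.add (hgc c).integrableOn
  have hi : ∀ c, IntegrableOn (fun z : ℂ => ‖c - z‖⁻¹) S := fun c =>
    (hi2 c).mono' (by fun_prop) (ae_of_all _ fun z => by simpa using hb c z)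
  refine ⟨volume.real S + ∫ z, g z, fun c => ⟨hi c, ?_⟩⟩
  calc ∫ z in S, ‖c - z‖⁻¹ ≤ ∫ z in S, (1 + g (c - z)) :=
        integral_mono (hi c) (hi2 c) fun z => hb c z
    _ = volume.real S + ∫ z in S, g (c - z) := by
        rw [integral_add hi1 (hgc c).integrableOn]; simp
    _ ≤ volume.real S + ∫ z, g (c - z) := by
        exact add_le_add le_rfl (setIntegral_le_integral (hgc c) (ae_of_all _ fun z => hg0 _))
    _ = _ := by rw [integral_sub_left_eq_self g]

/-- Tonelli: for almost every `t` the area integral of the norm is at most `N * M * K`, uniformly in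
the position of the pole `p t`. This justifies exchanging curve and area integrals. -/
theorem integrable_cauchy_prod {μ : Measure ℝ} [IsFiniteMeasure μ] {p c : ℝ → ℂ} {G : ℂ → ℂ}
    {M N : ℝ} {S : Set ℂ} (hp : AEMeasurable p μ) (hc : AEStronglyMeasurable c μ)
    (hcM : ∀ᵐ t ∂μ, ‖c t‖ ≤ M) (hG : Continuous G) (hGN : ∀ z, ‖G z‖ ≤ N)
    (hSm : MeasurableSet S) (hS : volume S ≠ ∞) (hGS : ∀ z ∉ S, G z = 0) :
    Integrable (fun q : ℝ × ℂ => G q.2 * c q.1 / (p q.1 - q.2)) (μ.prod volume) := by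
  obtain ⟨K, hK⟩ := exists_setIntegral_inv_norm_sub_le hS
  have hm : AEStronglyMeasurable (fun q : ℝ × ℂ => G q.2 * c q.1 / (p q.1 - q.2))
      (μ.prod volume) := by
    have h1 : AEMeasurable (fun q : ℝ × ℂ => p q.1) (μ.prod volume) := hp.comp_fst
    have h2 : AEMeasurable (fun q : ℝ × ℂ => c q.1) (μ.prod volume) := hc.aemeasurable.comp_fst
    have h3 : Measurable fun q : ℝ × ℂ => G q.2 := hG.measurable.comp measurable_snd
    exact ((h3.aemeasurable.mul h2).div (h1.sub measurable_snd.aemeasurable)).aestronglyMeasurable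
  have hb : ∀ t, ‖c t‖ ≤ M → ∀ z,
      ‖G z * c t / (p t - z)‖ ≤ S.indicator (fun z => N * M * ‖p t - z‖⁻¹) z := by
    intro t ht z
    by_cases hz : z ∈ S
    · rw [indicator_of_mem hz, norm_div, norm_mul, div_eq_mul_inv]
      gcongr
      · exact (norm_nonneg _).trans (hGN z)
      · exact hGN z
    · simp [indicator_of_notMem hz, hGS z hz]
  have hbi : ∀ t, Integrable (S.indicator fun z => N * M * ‖p t - z‖⁻¹) := fun t =>
    IntegrableOn.integrable_indicator ((hK (p t)).1.const_mul _) hSm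
  have hN : 0 ≤ N := (norm_nonneg _).trans (hGN 0)
  rw [integrable_prod_iff hm]
  constructor
  · filter_upwards [hcM] with t ht
    refine (hbi t).mono' ?_ (ae_of_all _ (hb t ht))
    have : Measurable fun z => G z * c t / (p t - z) := by
      have := hG.measurable
      fun_prop
    exact this.aestronglyMeasurable
  · refine Integrable.of_bound hm.norm.integral_prod_right' (N * M * K) ?_
    filter_upwards [hcM] with t ht
    have hM : 0 ≤ M := (norm_nonneg _).trans ht
    rw [Real.norm_of_nonneg (integral_nonneg fun _ => norm_nonneg _)]
    calc ∫ z, ‖G z * c t / (p t - z)‖ ≤ ∫ z, S.indicator (fun z => N * M * ‖p t - z‖⁻¹) z :=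
          integral_mono_of_nonneg (ae_of_all _ fun _ => norm_nonneg _) (hbi t)
            (ae_of_all _ (hb t ht))
      _ = N * M * ∫ z in S, ‖p t - z‖⁻¹ := by
          rw [integral_indicator hSm, integral_const_mul]
      _ ≤ N * M * K := by gcongr; exact (hK _).2

theorem circleIntegral_inv_sub_eq_zero {c w : ℂ} {R : ℝ} (hR : 0 ≤ R) (hw : w ∉ closedBall c R) :
    ∮ z in C(c, R), (z - w)⁻¹ = 0 := by
  have h : ∀ z ∈ closedBall c R, z - w ≠ 0 := fun z hz h => hw (sub_eq_zero.1 h ▸ hz)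
  refine Complex.circleIntegral_eq_zero_of_differentiable_on_off_countable hR countable_empty
    (ContinuousOn.inv₀ (by fun_prop) h) fun z hz => ?_
  exact ((differentiableAt_id.sub_const w).inv (h z (ball_subset_closedBall hz.1)))

/-- The area integral of the Cauchy kernel against `z ↦ ∮ g` over circles of a fixed radius. -/
theorem integral_circleIntegral_div {g : ℂ → ℂ} (hg : Continuous g) (hgs : HasCompactSupport g)
    {ε : ℝ} (hε : 0 < ε) (ζ : ℂ) :
    ∫ z, (∮ ξ in C(z, ε), g ξ) / (ζ - z) = 2 * Real.pi * Complex.I * ∫ ξ in ball ζ ε, g ξ := by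
  obtain ⟨N, hN⟩ := hgs.exists_bound_of_continuous hg
  have hN0 : 0 ≤ N := (norm_nonneg _).trans (hN 0)
  obtain ⟨R, hR⟩ := hgs.isBounded.subset_closedBall (0 : ℂ)
  have hgR : ∀ z ∉ closedBall (0 : ℂ) R, g z = 0 := fun z hz =>
    image_eq_zero_of_notMem_tsupport fun h => hz (hR h)
  set μ : Measure ℝ := volume.restrict (Ioc 0 (2 * Real.pi)) with hμ
  set u : ℝ → ℂ := circleMap 0 ε with hu
  have huc : Continuous u := continuous_circleMap 0 ε
  have hun : ∀ θ, ‖u θ‖ = ε := fun θ => by simp [hu, abs_of_pos hε]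
  have hpi : (0 : ℝ) ≤ 2 * Real.pi := Real.two_pi_pos.le
  have hmap : ∀ z θ, circleMap z ε θ = z + u θ := fun z θ => by simp [hu, circleMap]
  have hcirc : ∀ (z : ℂ) (f : ℂ → ℂ),
      ∮ ξ in C(z, ε), f ξ = ∫ θ, (u θ * Complex.I) * f (z + u θ) ∂μ := by
    intro z f
    rw [circleIntegral, intervalIntegral.integral_of_le hpi]
    congr 1 with θ
    rw [hmap z, deriv_circleMap, smul_eq_mul]
  have hvol : volume (closedBall (0 : ℂ) (R + ε)) ≠ ∞ := measure_closedBall_lt_top.ne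
  have hvol' : volume (closedBall (0 : ℂ) R) ≠ ∞ := measure_closedBall_lt_top.ne
  -- `g (z + u θ)` vanishes unless `‖z‖ ≤ R + ε`, so the integrand is dominated by a product of `‖ζ
  -- - z‖⁻¹` on that disc and a constant in `θ`.
  have hint1 : Integrable (fun q : ℂ × ℝ => (u q.2 * Complex.I) * g (q.1 + u q.2) / (ζ - q.1))
      (volume.prod μ) := by
    obtain ⟨K, hK⟩ := exists_setIntegral_inv_norm_sub_le hvol
    have hi1 : Integrable ((closedBall (0 : ℂ) (R + ε)).indicator fun z => ‖ζ - z‖⁻¹) :=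
      IntegrableOn.integrable_indicator (hK ζ).1 measurableSet_closedBall
    have hi2 : Integrable (fun _ : ℝ => ε * N) μ := integrable_const _
    refine (hi1.mul_prod hi2).mono' ?_ (ae_of_all _ fun q => ?_)
    · have h1 : Measurable fun q : ℂ × ℝ => (u q.2 * Complex.I) * g (q.1 + u q.2) :=
        Continuous.measurable (by fun_prop)
      exact (h1.div (measurable_const.sub measurable_fst)).aestronglyMeasurable
    · by_cases hq : q.1 ∈ closedBall (0 : ℂ) (R + ε)
      · rw [indicator_of_mem hq, norm_div, norm_mul, norm_mul, Complex.norm_I, hun, mul_one,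
          div_eq_mul_inv, mul_comm]
        gcongr
        exact hN _
      · have : g (q.1 + u q.2) = 0 := by
          apply hgR
          intro h
          apply hq
          rw [mem_closedBall_zero_iff] at h ⊢
          calc ‖q.1‖ = ‖q.1 + u q.2 - u q.2‖ := by simp
            _ ≤ ‖q.1 + u q.2‖ + ‖u q.2‖ := norm_sub_le _ _
            _ ≤ R + ε := by rw [hun]; gcongr
        simp [this, indicator_of_notMem hq]
  have hint2 : Integrable (fun q : ℝ × ℂ => g q.2 * (u q.1 * Complex.I) / ((ζ + u q.1) - q.2))
      (μ.prod volume) :=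
    integrable_cauchy_prod (p := fun θ => ζ + u θ) (c := fun θ => u θ * Complex.I) (M := ε)
      (Continuous.aemeasurable (by fun_prop)) (Continuous.aestronglyMeasurable (by fun_prop))
      (ae_of_all _ fun θ => by simp [hun]) hg hN measurableSet_closedBall hvol' hgR
  calc ∫ z, (∮ ξ in C(z, ε), g ξ) / (ζ - z)
      = ∫ z, ∫ θ, (u θ * Complex.I) * g (z + u θ) / (ζ - z) ∂μ := by
        congr 1 with z
        rw [hcirc, integral_div]
    _ = ∫ θ, (∫ z, (u θ * Complex.I) * g (z + u θ) / (ζ - z)) ∂μ := integral_integral_swap hint1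
    -- Substituting `ξ = z + u θ` moves the circle from the argument of `g` to the pole, leaving the
    -- integral of `1 / (w - ξ)` over the circle about `ζ`.
    _ = ∫ θ, (∫ ξ, g ξ * (u θ * Complex.I) / ((ζ + u θ) - ξ)) ∂μ := by
        congr 1 with θ
        rw [← integral_add_right_eq_self (fun ξ => g ξ * (u θ * Complex.I) / ((ζ + u θ) - ξ)) (u θ)]
        congr 1 with z
        rw [mul_comm, add_sub_add_right_eq_sub]
    _ = ∫ ξ, ∫ θ, g ξ * (u θ * Complex.I) / ((ζ + u θ) - ξ) ∂μ := integral_integral_swap hint2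
    _ = ∫ ξ, g ξ * ∮ w in C(ζ, ε), (w - ξ)⁻¹ := by
        congr 1 with ξ
        rw [hcirc, ← integral_const_mul]
        congr 1 with θ
        rw [div_eq_mul_inv, mul_assoc]
    -- That circle integral is `2πi` inside the disc and `0` outside; the circle itself is a null
    -- set.
    _ = ∫ ξ, (ball ζ ε).indicator (fun ξ => 2 * Real.pi * Complex.I * g ξ) ξ := by
        refine integral_congr_ae ?_
        have hs : ∀ᵐ ξ : ℂ, ξ ∉ sphere ζ ε :=
          measure_eq_zero_iff_ae_notMem.1 (Measure.addHaar_sphere volume ζ ε)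
        filter_upwards [hs] with ξ hξ
        by_cases h : ξ ∈ ball ζ ε
        · rw [circleIntegral.integral_sub_inv_of_mem_ball h, indicator_of_mem h, mul_comm]
        · rw [circleIntegral_inv_sub_eq_zero hε.le, indicator_of_notMem h, mul_zero]
          rw [← ball_union_sphere]
          exact fun h' => h'.elim h hξ
    _ = _ := by rw [integral_indicator measurableSet_ball, integral_const_mul]

/-! ### Area of thin neighbourhoods of a Lipschitz curve -/

/-- About `C (b - a) / ε` points of the curve are `ε`-dense in it, so discs of radius `2ε` about
them cover the thickening: `O(1/ε)` discs of area `O(ε²)`. -/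
theorem exists_volume_thickening_le {γ : ℝ → ℂ} {C : ℝ≥0} {a b : ℝ} (hab : a < b)
    (h : LipschitzOnWith C γ (Icc a b)) :
    ∃ A : ℝ, 0 ≤ A ∧ ∀ ε, 0 < ε → ε ≤ 1 →
      volume (thickening ε (γ '' Icc a b)) ≤ ENNReal.ofReal (A * ε) := by
  refine ⟨4 * Real.pi * (C * (b - a) + 3), by have := sub_pos.2 hab; positivity,
    fun ε hε hε1 => ?_⟩
  have hba := sub_pos.2 hab
  -- The extra `1` keeps `N` positive when `C = 0`. A parameter step `(b - a) / N` moves the curve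
  -- by at most `ε`.
  set N : ℕ := ⌈C * (b - a) / ε⌉₊ + 1 with hN
  have hNpos : (0 : ℝ) < N := by rw [hN]; positivity
  have hN1 : C * (b - a) / ε ≤ N := (Nat.le_ceil _).trans (by rw [hN]; push_cast; linarith)
  have hN2 : (N : ℝ) < C * (b - a) / ε + 2 := by
    have := Nat.ceil_lt_add_one (a := C * (b - a) / ε) (by positivity)
    rw [hN]; push_cast; linarith
  have hcover : thickening ε (γ '' Icc a b) ⊆
      ⋃ i ∈ Finset.range (N + 1), ball (γ (a + i * ((b - a) / N))) (2 * ε) := by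
    intro z hz
    obtain ⟨_, ⟨t, ht, rfl⟩, hzt⟩ := mem_thickening_iff.1 hz
    set i : ℕ := ⌊(t - a) * N / (b - a)⌋₊ with hi
    have hnn : 0 ≤ (t - a) * N / (b - a) := by
      have := sub_nonneg.2 ht.1
      positivity
    have hi1 : (i : ℝ) ≤ (t - a) * N / (b - a) := Nat.floor_le hnn
    have hi2 : (t - a) * N / (b - a) < i + 1 := Nat.lt_floor_add_one _
    have hi3 : i * ((b - a) / N) ≤ t - a := by
      rw [le_div_iff₀ hba] at hi1
      rw [← mul_div_assoc, div_le_iff₀ hNpos]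
      exact hi1
    have hi4 : t - a < i * ((b - a) / N) + (b - a) / N := by
      rw [div_lt_iff₀ hba] at hi2
      rw [← add_one_mul, ← mul_div_assoc, lt_div_iff₀ hNpos]
      exact hi2
    have hi5 : i ≤ N := by
      have : (i : ℝ) ≤ N := hi1.trans (by
        rw [div_le_iff₀ hba, mul_comm]
        gcongr
        exact ht.2)
      exact_mod_cast this
    have hp : 0 ≤ i * ((b - a) / N) := by positivity
    have hmem : a + i * ((b - a) / N) ∈ Icc a b := ⟨by linarith, by linarith [ht.2]⟩
    have hd : dist (γ t) (γ (a + i * ((b - a) / N))) ≤ ε := by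
      refine (h.dist_le_mul t ht _ hmem).trans ?_
      have : dist t (a + i * ((b - a) / N)) ≤ (b - a) / N := by
        rw [Real.dist_eq, abs_of_nonneg (by linarith)]
        linarith
      calc (C : ℝ) * dist t (a + i * ((b - a) / N)) ≤ C * ((b - a) / N) := by gcongr
        _ ≤ ε := by
          rw [← mul_div_assoc, div_le_iff₀ hNpos, mul_comm ε]
          rwa [div_le_iff₀ hε] at hN1
    simp only [mem_iUnion, Finset.mem_range]
    refine ⟨i, by omega, ?_⟩
    rw [mem_ball]
    calc dist z _ ≤ dist z (γ t) + dist (γ t) (γ (a + i * ((b - a) / N))) := dist_triangle _ _ _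
      _ < ε + ε := add_lt_add_of_lt_of_le hzt hd
      _ = 2 * ε := by ring
  refine (measure_mono hcover).trans ((measure_biUnion_finset_le _ _).trans ?_)
  simp only [Complex.volume_ball, Finset.sum_const, Finset.card_range, nsmul_eq_mul]
  have hpi : (NNReal.pi : ℝ≥0∞) = ENNReal.ofReal Real.pi := by
    rw [← NNReal.coe_real_pi, ENNReal.ofReal_coe_nnreal]
  rw [hpi, ← ENNReal.ofReal_pow (by positivity), ← ENNReal.ofReal_mul (by positivity),
    ← ENNReal.ofReal_natCast, ← ENNReal.ofReal_mul (by positivity)]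
  refine ENNReal.ofReal_le_ofReal ?_
  push_cast
  have h3 : (N + 1 : ℝ) * ε ≤ C * (b - a) + 3 := by
    have : (N + 1 : ℝ) ≤ C * (b - a) / ε + 3 := by linarith
    calc (N + 1 : ℝ) * ε ≤ (C * (b - a) / ε + 3) * ε := by gcongr
      _ = C * (b - a) + 3 * ε := by field_simp
      _ ≤ _ := by linarith
  calc (N + 1 : ℝ) * ((2 * ε) ^ 2 * Real.pi) = 4 * Real.pi * ((N + 1) * ε) * ε := by ring
    _ ≤ _ := by gcongr

/-! ### Boundary cycles in the plane -/

/-- The Lipschitz curves `γ k` on `[a k, b k]` together trace out the boundary of `D`, wind once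
about each point of `D` and do not wind about the points outside its closure. -/
structure IsBoundaryCycle (D : Set ℂ) {m : ℕ} (γ : Fin m → ℝ → ℂ) (a b : Fin m → ℝ) (C : ℝ≥0) :
    Prop where
  lt : ∀ k, a k < b k
  lipschitz : ∀ k, LipschitzOnWith C (γ k) (Icc (a k) (b k))
  trace_eq : ⋃ k, γ k '' Icc (a k) (b k) = frontier D
  winding_inside : ∀ z ∈ D, ∑ k, windingNumber (γ k) (a k) (b k) z = 1
  winding_outside : ∀ z ∉ closure D, ∑ k, windingNumber (γ k) (a k) (b k) z = 0

namespace IsBoundaryCycle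

variable {D : Set ℂ} {m : ℕ} {γ : Fin m → ℝ → ℂ} {a b : Fin m → ℝ} {C : ℝ≥0}

theorem exists_volume_thickening_frontier_le (h : IsBoundaryCycle D γ a b C) :
    ∃ A : ℝ, 0 ≤ A ∧ ∀ ε, 0 < ε → ε ≤ 1 →
      volume (thickening ε (frontier D)) ≤ ENNReal.ofReal (A * ε) := by
  choose A hA0 hA using fun k => exists_volume_thickening_le (h.lt k) (h.lipschitz k)
  refine ⟨∑ k, A k, Finset.sum_nonneg fun k _ => hA0 k, fun ε hε hε1 => ?_⟩
  rw [← h.trace_eq, thickening_iUnion, Finset.sum_mul,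
    ENNReal.ofReal_sum_of_nonneg fun k _ => mul_nonneg (hA0 k) hε.le]
  exact (measure_iUnion_fintype_le _ _).trans (Finset.sum_le_sum fun k _ => hA k ε hε hε1)

/-- Winding numbers are prescribed only off the boundary; this makes the remaining points negligible
in area integrals. -/
theorem volume_frontier (h : IsBoundaryCycle D γ a b C) : volume (frontier D) = 0 := by
  obtain ⟨A, -, hA⟩ := h.exists_volume_thickening_frontier_le
  have h1 : Tendsto (fun ε => ENNReal.ofReal (A * ε)) (𝓝[>] 0) (𝓝 0) := by
    have : Tendsto (fun ε => ENNReal.ofReal (A * ε)) (𝓝 0) (𝓝 (ENNReal.ofReal (A * 0))) :=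
      ENNReal.tendsto_ofReal ((continuous_const.mul continuous_id).tendsto 0)
    rw [mul_zero, ENNReal.ofReal_zero] at this
    exact this.mono_left nhdsWithin_le_nhds
  refine le_antisymm (ge_of_tendsto h1 ?_) zero_le
  filter_upwards [Ioc_mem_nhdsGT one_pos] with ε hε
  exact (measure_mono (self_subset_thickening hε.1 _)).trans (hA ε hε.1 hε.2)

theorem mem_frontier (h : IsBoundaryCycle D γ a b C) {k : Fin m} {t : ℝ}
    (ht : t ∈ Icc (a k) (b k)) : γ k t ∈ frontier D := by
  rw [← h.trace_eq]
  exact mem_iUnion.2 ⟨k, t, ht, rfl⟩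

theorem ae_mem_Ioo (k : Fin m) : ∀ᵐ t ∂volume.restrict (Ioc (a k) (b k)), t ∈ Ioo (a k) (b k) := by
  rw [← Measure.restrict_congr_set Ioo_ae_eq_Ioc]
  exact ae_restrict_mem measurableSet_Ioo

/-- At the endpoint `b k` the two-sided `deriv` may depend on values outside the interval, so the
bound is claimed only almost everywhere. -/
theorem ae_norm_deriv_le (h : IsBoundaryCycle D γ a b C) (k : Fin m) :
    ∀ᵐ t ∂volume.restrict (Ioc (a k) (b k)), ‖deriv (γ k) t‖ ≤ C := by
  filter_upwards [ae_mem_Ioo k] with t ht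
  exact norm_deriv_le_of_lipschitzOn (Icc_mem_nhds ht.1 ht.2) (h.lipschitz k)

theorem aemeasurable (h : IsBoundaryCycle D γ a b C) (k : Fin m) :
    AEMeasurable (γ k) (volume.restrict (Ioc (a k) (b k))) :=
  ((h.lipschitz k).continuousOn.mono Ioc_subset_Icc_self).aemeasurable measurableSet_Ioc

/-- A function that is continuous on the boundary can be integrated along the cycle. -/
theorem intervalIntegrable_mul_deriv (h : IsBoundaryCycle D γ a b C) {g : ℂ → ℂ}
    (hg : ContinuousOn g (frontier D)) (k : Fin m) :
    IntervalIntegrable (fun t => g (γ k t) * deriv (γ k) t) volume (a k) (b k) := by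
  have hc : ContinuousOn (fun t => g (γ k t)) (Icc (a k) (b k)) :=
    hg.comp (h.lipschitz k).continuousOn fun t ht => h.mem_frontier ht
  obtain ⟨N, hN⟩ := isCompact_Icc.exists_bound_of_continuousOn hc
  rw [intervalIntegrable_iff_integrableOn_Ioc_of_le (h.lt k).le]
  refine Integrable.of_bound (((hc.mono Ioc_subset_Icc_self).aestronglyMeasurable
    measurableSet_Ioc).mul (measurable_deriv _).aestronglyMeasurable) (N * C) ?_
  filter_upwards [ae_norm_deriv_le h k, ae_mem_Ioo k] with t h1 h2
  rw [norm_mul]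
  exact mul_le_mul (hN t (Ioo_subset_Icc_self h2)) h1 (norm_nonneg _)
    ((norm_nonneg _).trans (hN t (Ioo_subset_Icc_self h2)))

/-! ### Averaging over small discs -/

section Average

variable {g : ℂ → ℂ} {ε : ℝ}

theorem continuous_circleIntegral (hg : Continuous g) :
    Continuous fun z => ∮ ξ in C(z, ε), g ξ := by
  unfold circleIntegral
  refine intervalIntegral.continuous_parametric_intervalIntegral_of_continuous ?_ continuous_const
  simp only [deriv_circleMap, circleMap, Function.uncurry_def]
  fun_prop

/-- This is Green's formula for the disc averages of `g`, obtained without differentiating.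
`integral_circleIntegral_div` writes each average as a Cauchy transform of `H`; after exchanging
integrals, the curve integral of the kernel is a winding number, and the winding numbers sum to the
indicator of `D` almost everywhere. -/
theorem intervalIntegrable_setIntegral_ball_and_sum_eq (h : IsBoundaryCycle D γ a b C)
    (hDo : IsOpen D) (hg : Continuous g) (hgs : HasCompactSupport g) (hε : 0 < ε) :
    (∀ k, IntervalIntegrable (fun t => (∫ ξ in ball (γ k t) ε, g ξ) * deriv (γ k) t)
      volume (a k) (b k)) ∧
    ∑ k, ∫ t in (a k)..(b k), (∫ ξ in ball (γ k t) ε, g ξ) * deriv (γ k) t =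
      ∫ z in D, ∮ ξ in C(z, ε), g ξ := by
  set H : ℂ → ℂ := fun z => ∮ ξ in C(z, ε), g ξ with hH
  have hHc : Continuous H := continuous_circleIntegral hg
  obtain ⟨R, hR⟩ := hgs.isBounded.subset_closedBall (0 : ℂ)
  have hHR : ∀ z ∉ closedBall (0 : ℂ) (R + ε), H z = 0 := by
    intro z hz
    have : EqOn g 0 (sphere z ε) := by
      intro ξ hξ
      refine image_eq_zero_of_notMem_tsupport fun h' => hz ?_
      have := mem_closedBall_zero_iff.1 (hR h')
      rw [mem_closedBall_zero_iff]
      rw [mem_sphere_iff_norm, norm_sub_rev] at hξ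
      calc ‖z‖ = ‖ξ + (z - ξ)‖ := by simp
        _ ≤ ‖ξ‖ + ‖z - ξ‖ := norm_add_le _ _
        _ ≤ R + ε := by rw [hξ]; gcongr
    rw [hH]
    simp only
    rw [circleIntegral.integral_congr hε.le this]
    simp [circleIntegral]
  have hHs : HasCompactSupport H :=
    HasCompactSupport.intro (isCompact_closedBall 0 (R + ε)) hHR
  obtain ⟨N, hN⟩ := hHs.exists_bound_of_continuous hHc
  have h2pi : (2 * Real.pi * Complex.I : ℂ) ≠ 0 := Complex.two_pi_I_ne_zero
  have hint : ∀ k, Integrable (fun q : ℝ × ℂ => H q.2 * deriv (γ k) q.1 / (γ k q.1 - q.2))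
      ((volume.restrict (Ioc (a k) (b k))).prod volume) := fun k =>
    integrable_cauchy_prod (h.aemeasurable k) (measurable_deriv _).aestronglyMeasurable
      (h.ae_norm_deriv_le k) hHc hN measurableSet_closedBall measure_closedBall_lt_top.ne hHR
  have hz : ∀ k t, ∫ z, H z * deriv (γ k) t / (γ k t - z) =
      2 * Real.pi * Complex.I * ((∫ ξ in ball (γ k t) ε, g ξ) * deriv (γ k) t) := by
    intro k t
    rw [← mul_assoc, ← integral_circleIntegral_div hg hgs hε, ← integral_mul_const]
    congr 1 with z
    ring
  have hz' : ∀ k t, (∫ ξ in ball (γ k t) ε, g ξ) * deriv (γ k) t =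
      (2 * Real.pi * Complex.I)⁻¹ * ∫ z, H z * deriv (γ k) t / (γ k t - z) := by
    intro k t
    rw [hz, inv_mul_cancel_left₀ h2pi]
  have hw : ∀ k z, ∫ t in Ioc (a k) (b k), H z * deriv (γ k) t / (γ k t - z) =
      H z * (2 * Real.pi * Complex.I * windingNumber (γ k) (a k) (b k) z) := by
    intro k z
    rw [windingNumber, mul_inv_cancel_left₀ h2pi, intervalIntegral.integral_of_le (h.lt k).le,
      ← integral_const_mul]
    congr 1 with t
    ring
  constructor
  · intro k
    rw [intervalIntegrable_iff_integrableOn_Ioc_of_le (h.lt k).le]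
    simp only [hz']
    exact (hint k).integral_prod_left.const_mul _
  · calc ∑ k, ∫ t in (a k)..(b k), (∫ ξ in ball (γ k t) ε, g ξ) * deriv (γ k) t
        = ∑ k, (2 * Real.pi * Complex.I)⁻¹ *
          ∫ z, H z * (2 * Real.pi * Complex.I * windingNumber (γ k) (a k) (b k) z) := by
          refine Finset.sum_congr rfl fun k _ => ?_
          rw [intervalIntegral.integral_of_le (h.lt k).le]
          simp only [hz', integral_const_mul]
          rw [integral_integral_swap (hint k)]
          simp only [hw]
      _ = (2 * Real.pi * Complex.I)⁻¹ * ∫ z, ∑ k,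
            H z * (2 * Real.pi * Complex.I * windingNumber (γ k) (a k) (b k) z) := by
          rw [integral_finsetSum, Finset.mul_sum]
          intro k _
          simpa only [hw] using (hint k).integral_prod_right
      _ = (2 * Real.pi * Complex.I)⁻¹ * ∫ z, D.indicator (fun z => 2 * Real.pi * Complex.I * H z) z
          := by
          congr 1
          refine integral_congr_ae ?_
          have hs : ∀ᵐ z : ℂ, z ∉ frontier D := measure_eq_zero_iff_ae_notMem.1 h.volume_frontier
          filter_upwards [hs] with z hz
          rw [← Finset.mul_sum, ← Finset.mul_sum]
          by_cases hzD : z ∈ D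
          · rw [h.winding_inside z hzD, indicator_of_mem hzD]
            ring
          · rw [h.winding_outside z, indicator_of_notMem hzD]
            · ring
            · rw [closure_eq_self_union_frontier]
              exact fun h' => h'.elim hzD hz
      _ = _ := by
          rw [integral_indicator hDo.measurableSet, integral_const_mul, inv_mul_cancel_left₀ h2pi]

variable {η : ℝ}

/-- The constant `g z` has zero circle integral and may be subtracted, so the bound involves the
oscillation of `g` instead of its size. -/
theorem norm_circleIntegral_le_of_osc (hg : Continuous g) (hε : 0 < ε)
    (hη : ∀ x y, dist x y ≤ ε → ‖g x - g y‖ ≤ η) (z : ℂ) :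
    ‖∮ ξ in C(z, ε), g ξ‖ ≤ 2 * Real.pi * ε * η := by
  have h0 : ∮ ξ in C(z, ε), g z = 0 :=
    Complex.circleIntegral_eq_zero_of_differentiable_on_off_countable hε.le countable_empty
      continuousOn_const fun _ _ => differentiableAt_const _
  have h1 : ∮ ξ in C(z, ε), g ξ = ∮ ξ in C(z, ε), (g ξ - g z) := by
    rw [circleIntegral.integral_sub, h0, sub_zero]
    · exact hg.continuousOn.circleIntegrable hε.le
    · exact continuousOn_const.circleIntegrable hε.le
  rw [h1]
  exact circleIntegral.norm_integral_le_of_norm_le_const hε.le fun ξ hξ =>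
    hη _ _ (mem_sphere.1 hξ).le

theorem norm_setIntegral_ball_sub_le_of_osc (hg : Continuous g) (hε : 0 < ε)
    (hη : ∀ x y, dist x y ≤ ε → ‖g x - g y‖ ≤ η) (z : ℂ) :
    ‖(∫ ξ in ball z ε, g ξ) - (Real.pi * ε ^ 2 : ℝ) * g z‖ ≤ η * (Real.pi * ε ^ 2) := by
  have hv : volume.real (ball z ε) = Real.pi * ε ^ 2 := by
    simp [Measure.real, hε.le, mul_comm]
  have hi : IntegrableOn g (ball z ε) :=
    (hg.continuousOn.integrableOn_compact (isCompact_closedBall z ε)).mono_set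
      ball_subset_closedBall
  have h1 : (∫ ξ in ball z ε, g ξ) - (Real.pi * ε ^ 2 : ℝ) * g z = ∫ ξ in ball z ε, (g ξ - g z) := by
    rw [integral_sub hi (integrableOn_const measure_ball_lt_top.ne), setIntegral_const, hv,
      Complex.real_smul]
  rw [h1, ← hv]
  exact norm_setIntegral_le_of_norm_le_const measure_ball_lt_top fun ξ hξ =>
    hη _ _ (mem_ball.1 hξ).le

/-- The closed disc is connected, meets `D` and misses its frontier. -/
theorem closedBall_subset_of_notMem_thickening (hDo : IsOpen D) {z : ℂ} (hz : z ∈ D) (hε : 0 < ε)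
    (hn : z ∉ thickening (2 * ε) (frontier D)) : closedBall z ε ⊆ D := by
  have hd : ∀ ξ ∈ closedBall z ε, ξ ∉ frontier D := fun ξ hξ hf =>
    hn (mem_thickening_iff.2 ⟨ξ, hf, by rw [mem_closedBall, dist_comm] at hξ; linarith⟩)
  refine (convex_closedBall z ε).isPreconnected.subset_left_of_subset_union hDo
    isClosed_closure.isOpen_compl
    (disjoint_compl_right.mono_left subset_closure) (fun ξ hξ => ?_)
    ⟨z, mem_closedBall_self hε.le, hz⟩
  by_cases h : ξ ∈ D
  · exact Or.inl h
  · right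
    rw [mem_compl_iff, closure_eq_self_union_frontier]
    exact fun h' => h'.elim h (hd ξ hξ)

/-- Both sides of the averaged identity are compared at order `ε²`: the left is nearly `πε²` times
the curve integral, and the right is small because only a strip of area `O(ε)` contributes. The
factor `πε²` then cancels, leaving a bound proportional to `η`. -/
theorem norm_sum_integral_le_of_osc (h : IsBoundaryCycle D γ a b C) (hDo : IsOpen D)
    (hg : Continuous g) (hgs : HasCompactSupport g) (hd : DifferentiableOn ℂ g D) (hε : 0 < ε)
    (hη : ∀ x y, dist x y ≤ ε → ‖g x - g y‖ ≤ η) {A : ℝ}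
    (hA : volume (thickening (2 * ε) (frontier D)) ≤ ENNReal.ofReal (A * (2 * ε))) (hA0 : 0 ≤ A) :
    ‖∑ k, ∫ t in (a k)..(b k), g (γ k t) * deriv (γ k) t‖ ≤
      (4 * A + ∑ k, C * (b k - a k)) * η := by
  have hη0 : 0 ≤ η := (norm_nonneg _).trans (hη 0 0 (by simpa using hε.le))
  set T := thickening (2 * ε) (frontier D) with hT
  obtain ⟨hi, hs⟩ := h.intervalIntegrable_setIntegral_ball_and_sum_eq hDo hg hgs hε
  have hgi := h.intervalIntegrable_mul_deriv hg.continuousOn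
  have h1 : ‖∫ z in D, ∮ ξ in C(z, ε), g ξ‖ ≤ 2 * Real.pi * ε * η * (A * (2 * ε)) := by
    -- Away from the strip the whole disc lies in `D`, where `g` is holomorphic, so its circle
    -- integral vanishes.
    have he : ∫ z in D, ∮ ξ in C(z, ε), g ξ = ∫ z in D ∩ T, ∮ ξ in C(z, ε), g ξ := by
      refine setIntegral_eq_of_subset_of_forall_sdiff_eq_zero (f := fun z => ∮ ξ in C(z, ε), g ξ)
        hDo.measurableSet inter_subset_left fun z hz => ?_
      have hsub := closedBall_subset_of_notMem_thickening hDo hz.1 hε fun h' => hz.2 ⟨hz.1, h'⟩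
      exact Complex.circleIntegral_eq_zero_of_differentiable_on_off_countable hε.le
        countable_empty hg.continuousOn fun w hw =>
          hd.differentiableAt (hDo.mem_nhds (hsub (ball_subset_closedBall hw.1)))
    have hv : volume (D ∩ T) ≤ ENNReal.ofReal (A * (2 * ε)) :=
      (measure_mono inter_subset_right).trans hA
    rw [he]
    refine (norm_setIntegral_le_of_norm_le_const (hv.trans_lt ENNReal.ofReal_lt_top) fun z _ =>
      norm_circleIntegral_le_of_osc hg hε hη z).trans ?_
    gcongr
    exact ENNReal.toReal_le_of_le_ofReal (by positivity) hv
  set P : ℝ := Real.pi * ε ^ 2 with hP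
  have hP0 : 0 < P := by positivity
  have h2 : ‖(∑ k, ∫ t in (a k)..(b k), (∫ ξ in ball (γ k t) ε, g ξ) * deriv (γ k) t) -
      P * ∑ k, ∫ t in (a k)..(b k), g (γ k t) * deriv (γ k) t‖ ≤
        ∑ k, η * P * C * (b k - a k) := by
    rw [Finset.mul_sum, ← Finset.sum_sub_distrib]
    refine (norm_sum_le _ _).trans (Finset.sum_le_sum fun k _ => ?_)
    rw [← intervalIntegral.integral_const_mul,
      ← intervalIntegral.integral_sub (hi k) ((hgi k).const_mul _),
      ← abs_of_pos (sub_pos.2 (h.lt k))]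
    refine intervalIntegral.norm_integral_le_of_norm_le_const_ae ?_
    rw [uIoc_of_le (h.lt k).le, ← ae_restrict_iff' measurableSet_Ioc]
    filter_upwards [h.ae_norm_deriv_le k] with t ht
    rw [← mul_assoc, ← sub_mul, norm_mul]
    gcongr
    exact norm_setIntegral_ball_sub_le_of_osc hg hε hη _
  set Q := ∑ k, ∫ t in (a k)..(b k), g (γ k t) * deriv (γ k) t
  rw [hs] at h2
  have h3 : P * ‖Q‖ ≤ P * ((4 * A + ∑ k, C * (b k - a k)) * η) := by
    calc P * ‖Q‖ = ‖(P : ℂ) * Q‖ := by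
          rw [norm_mul, Complex.norm_real, Real.norm_of_nonneg hP0.le]
      _ ≤ ‖∫ z in D, ∮ ξ in C(z, ε), g ξ‖ + ‖(∫ z in D, ∮ ξ in C(z, ε), g ξ) - P * Q‖ := by
          rw [← norm_neg ((∫ z in D, ∮ ξ in C(z, ε), g ξ) - P * Q)]
          refine le_trans (le_of_eq ?_) (norm_add_le _ _)
          congr 1
          ring
      _ ≤ 2 * Real.pi * ε * η * (A * (2 * ε)) + ∑ k, η * P * C * (b k - a k) := add_le_add h1 h2
      _ = _ := by
          have : ∑ k, η * P * C * (b k - a k) = η * P * ∑ k, C * (b k - a k) := by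
            rw [Finset.mul_sum]
            exact Finset.sum_congr rfl fun k _ => by ring
          rw [this, hP]
          ring
  exact le_of_mul_le_mul_left h3 hP0

end Average

/-! ### Cauchy's theorem and formula up to the boundary -/

/-- Cauchy's theorem for functions that are holomorphic in `D` and merely continuous up to the
boundary. -/
theorem sum_integral_eq_zero (h : IsBoundaryCycle D γ a b C) (hDo : IsOpen D)
    (hDb : Bornology.IsBounded D) {g : ℂ → ℂ} (hc : ContinuousOn g (closure D))
    (hd : DifferentiableOn ℂ g D) :
    ∑ k, ∫ t in (a k)..(b k), g (γ k t) * deriv (γ k) t = 0 := by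
  have hK : IsCompact (closure D) := hDb.isCompact_closure
  -- Discs about boundary points leave `closure D`, so `g` is extended by Tietze and cut off.
  -- Compact support gives uniform continuity; no holomorphy is needed outside `D`.
  obtain ⟨G, hG⟩ := ContinuousMap.exists_restrict_eq (isClosed_closure (s := D))
    ⟨(closure D).domRestrict g, hc.domRestrict⟩
  have hGg : ∀ z ∈ closure D, G z = g z := fun z hz =>
    congrArg (fun φ : C(closure D, ℂ) => φ ⟨z, hz⟩) hG
  obtain ⟨χ, hχ1, -, hχs, -⟩ := exists_continuous_one_zero_of_isCompact hK isClosed_empty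
    (disjoint_empty _)
  set g' : ℂ → ℂ := fun z => (χ z : ℂ) * G z with hg'
  have hg'c : Continuous g' := by fun_prop
  have hg's : HasCompactSupport g' := by
    have : HasCompactSupport fun z => (χ z : ℂ) := hχs.comp_left (g := ((↑) : ℝ → ℂ)) (by simp)
    exact this.mul_right
  have hgg : EqOn g' g (closure D) := fun z hz => by simp [hg', hχ1 hz, hGg z hz]
  have hd' : DifferentiableOn ℂ g' D := hd.congr fun z hz => hgg (subset_closure hz)
  have hsum : ∑ k, ∫ t in (a k)..(b k), g (γ k t) * deriv (γ k) t =
      ∑ k, ∫ t in (a k)..(b k), g' (γ k t) * deriv (γ k) t := by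
    refine Finset.sum_congr rfl fun k _ => intervalIntegral.integral_congr fun t ht => ?_
    rw [uIcc_of_le (h.lt k).le] at ht
    simp only [hgg (frontier_subset_closure (h.mem_frontier ht))]
  rw [hsum]
  obtain ⟨A, hA0, hA⟩ := h.exists_volume_thickening_frontier_le
  have hu := hg's.uniformContinuous_of_continuous hg'c
  set B := 4 * A + ∑ k, C * (b k - a k)
  have hle : ∀ η > 0, ‖∑ k, ∫ t in (a k)..(b k), g' (γ k t) * deriv (γ k) t‖ ≤ B * η := by
    intro η hη
    obtain ⟨δ, hδ, hδη⟩ := Metric.uniformContinuous_iff.1 hu η hη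
    -- Half of `δ` makes the oscillation at scale `ε` at most `η`; the cap `1/2` makes the strip
    -- width `2ε` at most `1`, as the area bound requires.
    have hε : 0 < min (δ / 2) (1 / 2) := by positivity
    refine norm_sum_integral_le_of_osc h hDo hg'c hg's hd' hε (fun x y hxy => ?_)
      (hA _ (by positivity) ?_) hA0
    · rw [← dist_eq_norm]
      exact (hδη (hxy.trans_lt ((min_le_left _ _).trans_lt (by linarith)))).le
    · linarith [min_le_right (δ / 2) (1 / 2)]
  have hlim : Tendsto (fun η => B * η) (𝓝[>] 0) (𝓝 0) := by
    have : Tendsto (fun η => B * η) (𝓝 0) (𝓝 (B * 0)) :=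
      (continuous_const.mul continuous_id).tendsto 0
    rw [mul_zero] at this
    exact this.mono_left nhdsWithin_le_nhds
  exact norm_le_zero_iff.1 (ge_of_tendsto hlim (eventually_mem_nhdsWithin.mono fun η hη => hle η hη))

theorem intervalIntegrable_inv_mul_deriv (h : IsBoundaryCycle D γ a b C) (hDo : IsOpen D)
    {g : ℂ → ℂ} (hc : ContinuousOn g (closure D)) {z : ℂ} (hz : z ∈ D) (k : Fin m) :
    IntervalIntegrable (fun t => (γ k t - z)⁻¹ * g (γ k t) * deriv (γ k) t) volume (a k) (b k) := by
  refine h.intervalIntegrable_mul_deriv (g := fun ζ => (ζ - z)⁻¹ * g ζ) ?_ k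
  refine ContinuousOn.mul (ContinuousOn.inv₀ (by fun_prop) fun ζ hζ => ?_)
    (hc.mono frontier_subset_closure)
  rw [sub_ne_zero]
  rintro rfl
  exact (disjoint_frontier_iff_isOpen.2 hDo).ne_of_mem hζ hz rfl

/-- Cauchy's integral formula for functions that are holomorphic in `D` and continuous up to the
boundary. -/
theorem sum_integral_inv_mul (h : IsBoundaryCycle D γ a b C) (hDo : IsOpen D)
    (hDb : Bornology.IsBounded D) {g : ℂ → ℂ} (hc : ContinuousOn g (closure D))
    (hd : DifferentiableOn ℂ g D) {z : ℂ} (hz : z ∈ D) :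
    ∑ k, ∫ t in (a k)..(b k), (γ k t - z)⁻¹ * g (γ k t) * deriv (γ k) t =
      2 * Real.pi * Complex.I * g z := by
  have hnhds : D ∈ 𝓝 z := hDo.mem_nhds hz
  -- The singularity of the difference quotient at `z` is removable. On the cycle it is `(g(ζ) -
  -- g(z)) / (ζ - z)`, and the subtracted term contributes the total winding number `1` times `2πi
  -- g(z)`.
  have h1 := h.sum_integral_eq_zero hDo hDb (g := dslope g z)
    ((continuousOn_dslope (mem_of_superset hnhds subset_closure)).2
      ⟨hc, hd.differentiableAt hnhds⟩)
    ((Complex.differentiableOn_dslope hnhds).2 hd)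
  have h2 : ∀ k, ∫ t in (a k)..(b k), dslope g z (γ k t) * deriv (γ k) t =
      (∫ t in (a k)..(b k), (γ k t - z)⁻¹ * g (γ k t) * deriv (γ k) t) -
        2 * Real.pi * Complex.I * windingNumber (γ k) (a k) (b k) z * g z := by
    intro k
    rw [windingNumber, mul_inv_cancel_left₀ Complex.two_pi_I_ne_zero,
      ← intervalIntegral.integral_mul_const, ← intervalIntegral.integral_sub
      (h.intervalIntegrable_inv_mul_deriv hDo hc hz k)]
    · refine intervalIntegral.integral_congr fun t ht => ?_
      rw [uIcc_of_le (h.lt k).le] at ht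
      have hne : γ k t ≠ z := fun h' =>
        (disjoint_frontier_iff_isOpen.2 hDo).ne_of_mem (h.mem_frontier ht) hz h'
      simp only [dslope_of_ne _ hne, slope_def_field]
      ring
    · refine (((h.intervalIntegrable_inv_mul_deriv hDo (g := fun _ => 1)
        continuousOn_const hz k)).mul_const (g z)).congr fun t _ => ?_
      ring
  simp only [h2, Finset.sum_sub_distrib, ← Finset.sum_mul, ← Finset.mul_sum,
    h.winding_inside z hz, mul_one] at h1
  exact sub_eq_zero.1 h1

end IsBoundaryCycle

/-! ### The complex structure given by left multiplication by `J` -/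

section Slice

set_option linter.unusedSectionVars false

variable {A : Type*} [NormedSpaceNonAssocRing A] [NormedSpace ℝ A]

/-- The real part `x + y i ↦ x` as a continuous linear map. -/
noncomputable def fstPartCLM : Complexification A →L[ℝ] A := ContinuousLinearMap.fst ℝ A A

/-- The imaginary part `x + y i ↦ y` as a continuous linear map. -/
noncomputable def sndPartCLM : Complexification A →L[ℝ] A := ContinuousLinearMap.snd ℝ A A

theorem Complexification.ext_parts {v w : Complexification A}
    (h1 : Complexification.fstPart v = Complexification.fstPart w)
    (h2 : Complexification.sndPart v = Complexification.sndPart w) : v = w := Prod.ext h1 h2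

/-- Complex conjugation as a continuous linear map. -/
noncomputable def conjugateCLM : Complexification A →L[ℝ] Complexification A :=
  ContinuousLinearMap.prod (ContinuousLinearMap.fst ℝ A A) (-ContinuousLinearMap.snd ℝ A A)

section LeftMul

variable [IsScalarTower ℝ A A] [SMulCommClass ℝ A A] [FiniteDimensional ℝ A]

/-- Left multiplication by `a` as a continuous linear map. -/
noncomputable def mulLeftCLM (a : A) : A →L[ℝ] A :=
  LinearMap.toContinuousLinearMap (LinearMap.mulLeft ℝ a)

/-- The restriction `ζ ↦ F₁(ζ) + J F₂(ζ)` of the slice function `𝓘(F)` to the plane `ℂ_J`. -/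
def sliceRestriction (J : A) (F : ℂ → Complexification A) (ζ : ℂ) : A :=
  Complexification.fstPart (F ζ) + J * Complexification.sndPart (F ζ)

/-- `x + y i ↦ x + J y` as a continuous linear map. -/
noncomputable def evalCLM (J : A) : Complexification A →L[ℝ] A :=
  fstPartCLM + (mulLeftCLM J).comp sndPartCLM

theorem evalCLM_apply (J : A) (v : Complexification A) :
    evalCLM J v = Complexification.fstPart v + J * Complexification.sndPart v := rfl

end LeftMul

theorem phi_add (J : A) (z w : ℂ) : phi J (z + w) = phi J z + phi J w := by
  simp only [phi, Complex.add_re, Complex.add_im, add_smul]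
  abel

theorem phi_smul (J : A) (r : ℝ) (z : ℂ) : phi J (r • z) = r • phi J z := by
  simp only [phi, Complex.smul_re, Complex.smul_im, smul_add, smul_eq_mul, mul_smul]

/-- `φ_J` as a continuous linear map. -/
noncomputable def phiCLM (J : A) : ℂ →L[ℝ] A :=
  LinearMap.toContinuousLinearMap
    { toFun := phi J, map_add' := phi_add J, map_smul' := phi_smul J }

theorem phi_mul [IsScalarTower ℝ A A] (J : A) (z : ℂ) (u : A) :
    phi J z * u = z.re • u + z.im • (J * u) := by
  rw [phi, add_mul, smul_mul_assoc, smul_mul_assoc, one_mul]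

variable [StarRing A]

/-- Left alternativity gives `J(Ju) = (JJ)u`. This is the substitute for associativity throughout.
-/
theorem mul_mul_of_mem [IsAlternative A] {J : A} (hJ : J ∈ imagUnits A) (u : A) :
    J * (J * u) = -u := by
  have h := IsAlternative.left_alternative J u
  rw [associator_apply, sub_eq_zero, hJ.2] at h
  rw [← h, neg_mul, one_mul]

variable [IsScalarTower ℝ A A] [SMulCommClass ℝ A A]

/-- Thus `z • u = φ_J(z) u` is a complex vector space structure on `A`, even though `A` need not be
associative. -/
theorem phi_mul_phi_mul [IsAlternative A] {J : A} (hJ : J ∈ imagUnits A) (z w : ℂ) (u : A) :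
    phi J z * (phi J w * u) = phi J (z * w) * u := by
  simp only [phi_mul, mul_add, mul_smul_comm, mul_mul_of_mem hJ, Complex.mul_re, Complex.mul_im]
  module

theorem phi_mul_phi [IsAlternative A] {J : A} (hJ : J ∈ imagUnits A) (z w : ℂ) :
    phi J z * phi J w = phi J (z * w) := by
  simpa using phi_mul_phi_mul hJ z w 1

theorem phi_I_mul [IsAlternative A] {J : A} (hJ : J ∈ imagUnits A) (w : ℂ) (u : A) :
    phi J (Complex.I * w) * u = J * (phi J w * u) := by
  rw [← phi_mul_phi_mul hJ, phi_mul]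
  simp

/-- The functional `a ↦ ℓ(a) - i ℓ(J a)`, which is complex linear for the complex structure on `A`
given by the left multiplication by `J`. -/
noncomputable def complexFunctional [FiniteDimensional ℝ A] (J : A) (l : A →L[ℝ] ℝ) : A →L[ℝ] ℂ :=
  Complex.ofRealCLM.comp l -
    Complex.I • Complex.ofRealCLM.comp (l.comp (mulLeftCLM J))

section

variable [FiniteDimensional ℝ A]

theorem complexFunctional_apply (J : A) (l : A →L[ℝ] ℝ) (u : A) :
    complexFunctional J l u = l u - Complex.I * l (J * u) := rfl

theorem complexFunctional_phi_mul [IsAlternative A] {J : A} (hJ : J ∈ imagUnits A) (l : A →L[ℝ] ℝ)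
    (z : ℂ) (u : A) : complexFunctional J l (phi J z * u) = z * complexFunctional J l u := by
  simp only [complexFunctional_apply, phi_mul, mul_mul_of_mem hJ, map_add, map_smul, map_neg]
  apply Complex.ext <;> simp

theorem re_complexFunctional (J : A) (l : A →L[ℝ] ℝ) (u : A) :
    (complexFunctional J l u).re = l u := by
  simp [complexFunctional_apply]

end

/-! ### Slice planes and the Cauchy kernel -/

section Star

variable [StarModule ℝ A] [Nontrivial A]

theorem star_phi {J : A} (hJ : J ∈ imagUnits A) (z : ℂ) : star (phi J z) = phi J (conj z) := by
  rw [phi, star_add, star_smul_one, star_smul, star_trivial, star_of_mem hJ]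
  simp [phi]

theorem toReal_trace_phi {J : A} (hJ : J ∈ imagUnits A) (z : ℂ) :
    toReal (trace (phi J z)) = 2 * z.re := by
  rw [trace, star_phi hJ, ← toReal_smul_one (A := A) (2 * z.re)]
  congr 1
  simp only [phi, Complex.conj_re, Complex.conj_im]
  module

theorem toReal_sqNorm_phi [IsAlternative A] {J : A} (hJ : J ∈ imagUnits A) (z : ℂ) :
    toReal (sqNorm (phi J z)) = Complex.normSq z := by
  have h : phi J (Complex.normSq z : ℂ) = Complex.normSq z • (1 : A) := by simp [phi]
  rw [sqNorm, star_phi hJ, phi_mul_phi hJ, Complex.mul_conj, h, toReal_smul_one]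

theorem coneInv_of_mem {J : A} (hJ : J ∈ imagUnits A) : coneInv J = -J := by
  have h : sqNorm J = (1 : ℝ) • (1 : A) := by
    rw [sqNorm, star_of_mem hJ, mul_neg, hJ.2, neg_neg, one_smul]
  rw [coneInv, h, toReal_smul_one, inv_one, one_smul, star_of_mem hJ]

theorem coneInv_mul_phi [IsAlternative A] {J : A} (hJ : J ∈ imagUnits A) (z : ℂ) :
    coneInv J * phi J z = phi J (-Complex.I * z) := by
  rw [coneInv_of_mem hJ, ← phi_mul_phi hJ]
  simp [phi]

theorem phi_injective {J : A} (hJ : J ∈ imagUnits A) : Function.Injective (phi J) := by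
  intro z w h
  rcases phi_eq_phi hJ hJ h with ⟨h, -⟩ | ⟨-, h⟩
  · exact h.symm
  · refine absurd (?_ : J = (0 : ℝ) • (1 : A)) (not_real_of_mem hJ 0)
    rw [zero_smul]
    have h2 : (2 : ℝ) • J = 0 := by
      rw [two_smul]
      nth_rewrite 1 [h]
      exact neg_add_cancel _
    exact (smul_eq_zero.1 h2).resolve_left two_ne_zero

theorem phi_mem_slicePlane (J : A) (z : ℂ) : phi J z ∈ slicePlane J :=
  Submodule.mem_span_pair.2 ⟨z.re, z.im, rfl⟩

/-- As a linear bijection of finite-dimensional spaces, `φ_J` is a homeomorphism onto `ℂ_J`, and it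
carries `D` exactly onto `Ω_D ∩ ℂ_J`. Conjugation invariance is needed because a point may also be
represented with the unit `-J` and the conjugate parameter. -/
theorem sliceBoundary_eq {J : A} (hJ : J ∈ imagUnits A) {D : Set ℂ}
    (hD : ∀ z ∈ D, conj z ∈ D) : sliceBoundary D J = phi J '' frontier D := by
  let e₀ : ℂ →ₗ[ℝ] slicePlane J :=
    LinearMap.codRestrict (slicePlane J) (phiCLM J : ℂ →ₗ[ℝ] A) (phi_mem_slicePlane J)
  have he₀ : ∀ z, (e₀ z : A) = phi J z := fun _ => rfl
  have hb : Function.Bijective e₀ := by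
    refine ⟨fun z w h => phi_injective hJ (congrArg Subtype.val h), fun y => ?_⟩
    obtain ⟨r, s, h⟩ := Submodule.mem_span_pair.1 y.2
    exact ⟨⟨r, s⟩, Subtype.ext h⟩
  have : FiniteDimensional ℝ (slicePlane J) := Module.Finite.of_surjective e₀ hb.2
  let e : ℂ ≃ₜ slicePlane J :=
    (LinearEquiv.ofBijective e₀ hb).toContinuousLinearEquiv.toHomeomorph
  have he : ∀ z, (e z : A) = phi J z := fun _ => rfl
  have hset : {y : slicePlane J | (y : A) ∈ circularSet A D} = e '' D := by
    ext y
    constructor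
    · rintro ⟨z, hz, K, hK, h⟩
      obtain ⟨w, rfl⟩ := e.surjective y
      rw [he] at h
      refine ⟨w, ?_, rfl⟩
      rcases phi_eq_phi hJ hK h with ⟨h, -⟩ | ⟨h, -⟩
      · exact h ▸ hz
      · have := hD z hz
        rwa [h, Complex.conj_conj] at this
    · rintro ⟨z, hz, rfl⟩
      exact ⟨z, hz, J, hJ, he z⟩
  rw [sliceBoundary, hset, ← e.image_frontier, image_image]
  rfl

theorem IsOrientedBoundary.exists_isBoundaryCycle {J : A} (hJ : J ∈ imagUnits A) {D : Set ℂ}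
    (hD : ∀ z ∈ D, conj z ∈ D) {m : ℕ} {γ : Fin m → ℝ → ℂ} {a b : Fin m → ℝ}
    (h : IsOrientedBoundary J D γ a b) : ∃ C : ℝ≥0, IsBoundaryCycle D γ a b C := by
  choose C hC using fun k => (h.isClosedPiecewiseC1 k).exists_lipschitzOnWith
  refine ⟨Finset.univ.sup C, fun k => (h.isClosedPiecewiseC1 k).lt,
    fun k => (hC k).weaken (Finset.le_sup (Finset.mem_univ k)), ?_, h.winding_inside,
    h.winding_outside⟩
  have h1 := h.trace_eq
  rw [sliceBoundary_eq hJ hD] at h1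
  refine (image_injective.2 (phi_injective hJ)) ?_
  rw [← h1, image_iUnion]
  simp only [image_image]

/-- The Cauchy kernel is induced by a stem function. -/
theorem isStem_cauchyKernelStem (y : A) : IsStem univ (cauchyKernelStem y) := by
  intro z _
  have h : ((conj z) ^ 2 - conj z * (toReal (trace y) : ℂ) + (toReal (sqNorm y) : ℂ))⁻¹ =
      conj ((z ^ 2 - z * (toReal (trace y) : ℂ) + (toReal (sqNorm y) : ℂ))⁻¹) := by
    simp [map_inv₀]
  rw [cauchyKernelStem, h, cauchyKernelStem]
  generalize (z ^ 2 - z * (toReal (trace y) : ℂ) + (toReal (sqNorm y) : ℂ))⁻¹ = c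
  refine Complexification.ext_parts ?_ ?_
  · change (conj c).re • (star y - (conj z).re • (1 : A)) -
        (conj c).im • ((0 : A) - (conj z).im • (1 : A)) =
      c.re • (star y - z.re • (1 : A)) - c.im • ((0 : A) - z.im • (1 : A))
    simp only [Complex.conj_re, Complex.conj_im]
    module
  · change (conj c).re • ((0 : A) - (conj z).im • (1 : A)) +
        (conj c).im • (star y - (conj z).re • (1 : A)) =
      -(c.re • ((0 : A) - z.im • (1 : A)) + c.im • (star y - z.re • (1 : A)))
    simp only [Complex.conj_re, Complex.conj_im]
    module

/-- A constant has no `i`-part, so the product acts separately on the two parts of the kernel, each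
multiplying `u` on the left. Writing the complex factor as `c` leaves only real scalars, `star y *
u` and `u`. -/
theorem cauchyKernelMulConst_phi {K : A} (hK : K ∈ imagUnits A) (y u : A) (z : ℂ) {c : ℂ}
    (hc : (z ^ 2 - z * (toReal (trace y) : ℂ) + (toReal (sqNorm y) : ℂ))⁻¹ = c) :
    cauchyKernelMulConst y u (phi K z) =
      (c.re • (star y * u) - (c * z).re • u) + K * (c.im • (star y * u) - (c * z).im • u) := by
  have hst : IsStem univ fun z => cauchyKernelStem y z * Complexification.ofA u := by
    intro w _
    simp only [isStem_cauchyKernelStem y w (mem_univ _)]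
    generalize cauchyKernelStem y w = v
    refine Complexification.ext_parts ?_ ?_
    · change v.1 * u - (-v.2) * 0 = v.1 * u - v.2 * 0
      simp
    · change v.1 * 0 + (-v.2) * u = -(v.1 * 0 + v.2 * u)
      simp
  rw [cauchyKernelMulConst, sliceProduct, sliceFunction_phi hst (mem_univ z) hK, cauchyKernelStem,
    hc]
  change ((c.re • (star y - z.re • (1 : A)) - c.im • ((0 : A) - z.im • (1 : A))) * u -
      (c.re • ((0 : A) - z.im • (1 : A)) + c.im • (star y - z.re • (1 : A))) * 0) +
      K * ((c.re • (star y - z.re • (1 : A)) - c.im • ((0 : A) - z.im • (1 : A))) * 0 +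
      (c.re • ((0 : A) - z.im • (1 : A)) + c.im • (star y - z.re • (1 : A))) * u) = _
  simp only [mul_zero, sub_zero, zero_add, zero_sub, add_mul, sub_mul, smul_mul_assoc, one_mul,
    neg_mul, Complex.mul_re, Complex.mul_im]
  congr 1
  · module
  · congr 1
    module

/-- The slice product of the Cauchy kernel with a constant, in terms of the complex Cauchy kernels
at `z` and at its conjugate. -/
theorem cauchyKernelMulConst_phi_phi [IsAlternative A] {J K : A} (hJ : J ∈ imagUnits A)
    (hK : K ∈ imagUnits A) {z ζ : ℂ} (h1 : ζ ≠ z) (h2 : ζ ≠ conj z) (g : ℂ) (u : A) :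
    cauchyKernelMulConst (phi J ζ) (phi J g * u) (phi K z) =
      (1 / 2 : ℝ) • (phi J ((ζ - z)⁻¹ * g) * u + phi J ((ζ - conj z)⁻¹ * g) * u) +
        K * (J * ((1 / 2 : ℝ) •
          (phi J ((ζ - conj z)⁻¹ * g) * u - phi J ((ζ - z)⁻¹ * g) * u))) := by
  -- For `y = φ_J(ζ)`, the polynomial `z² - z t(y) + n(y)` has the roots `ζ` and `ζ̄`. One factor
  -- cancels against `ζ̄ - z` in `e1`.
  set c : ℂ := ((z - ζ) * (z - conj ζ))⁻¹ with hc
  have hc' : (z ^ 2 - z * (toReal (trace (phi J ζ)) : ℂ) + (toReal (sqNorm (phi J ζ)) : ℂ))⁻¹ =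
      c := by
    rw [hc, toReal_trace_phi hJ, toReal_sqNorm_phi hJ]
    congr 1
    rw [← Complex.mul_conj, Complex.ofReal_mul, Complex.ofReal_ofNat, Complex.re_eq_add_conj]
    ring
  have n1 : ζ - z ≠ 0 := sub_ne_zero.2 h1
  have n2 : ζ - conj z ≠ 0 := sub_ne_zero.2 h2
  have n3 : z - ζ ≠ 0 := sub_ne_zero.2 h1.symm
  have n4 : z - conj ζ ≠ 0 := by
    intro h
    apply n2
    rw [sub_eq_zero.1 h, Complex.conj_conj, sub_self]
  have n5 : conj z - ζ ≠ 0 := sub_ne_zero.2 h2.symm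
  have n6 : conj z - conj ζ ≠ 0 := by
    rw [← map_sub]
    exact (map_ne_zero _).2 n3
  have e1 : c * (conj ζ - z) = (ζ - z)⁻¹ := by
    rw [hc]; field_simp; ring
  have e2 : conj c * (conj ζ - conj z) = (ζ - conj z)⁻¹ := by
    rw [hc]; simp only [map_inv₀, map_mul, map_sub, Complex.conj_conj]; field_simp; ring
  -- Expressing real and imaginary parts of `c` and `c z` through conjugates makes the two stem
  -- components the half sum and half difference of the kernels at `z` and `z̄`; the factor `i` in
  -- `r2` becomes left multiplication by `J`.
  have r1 : ((c.re : ℂ) * conj ζ - ((c * z).re : ℂ)) =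
      (1 / 2 : ℂ) * ((ζ - z)⁻¹ + (ζ - conj z)⁻¹) := by
    rw [← e1, ← e2, Complex.re_eq_add_conj, Complex.re_eq_add_conj, map_mul]
    ring
  have r2 : ((c.im : ℂ) * conj ζ - ((c * z).im : ℂ)) =
      Complex.I * ((1 / 2 : ℂ) * ((ζ - conj z)⁻¹ - (ζ - z)⁻¹)) := by
    rw [← e1, ← e2, Complex.im_eq_sub_conj, Complex.im_eq_sub_conj, map_mul]
    field_simp
    rw [Complex.I_sq]
    ring
  have s : ∀ (r r' : ℝ) (w w' : ℂ), r • (phi J w * u) - r' • (phi J w' * u) =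
      phi J (r * w - r' * w') * u := by
    intro r r' w w'
    simp only [phi_mul, Complex.sub_re, Complex.sub_im, Complex.re_ofReal_mul,
      Complex.im_ofReal_mul]
    module
  have s' : ∀ (r : ℝ) (w : ℂ), r • (phi J w * u) = phi J (r * w) * u := by
    intro r w
    simpa using s r 0 w 0
  rw [cauchyKernelMulConst_phi hK _ _ _ hc', star_phi hJ, phi_mul_phi_mul hJ, s, s,
    ← add_mul, ← sub_mul, ← phi_add]
  have hsub : phi J ((ζ - conj z)⁻¹ * g) - phi J ((ζ - z)⁻¹ * g) =
      phi J ((ζ - conj z)⁻¹ * g - (ζ - z)⁻¹ * g) := by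
    rw [eq_comm, ← sub_eq_zero]
    simp only [phi, Complex.sub_re, Complex.sub_im]
    module
  rw [hsub, s', s', ← phi_I_mul hJ]
  congr 1
  · congr 2
    calc _ = ((c.re : ℂ) * conj ζ - ((c * z).re : ℂ)) * g := by ring
      _ = _ := by rw [r1]; push_cast; ring
  · congr 3
    calc _ = ((c.im : ℂ) * conj ζ - ((c * z).im : ℂ)) * g := by ring
      _ = _ := by rw [r2]; push_cast; ring

end Star

end Slice

/-! ### Slice regular functions and Cauchy's formula on `ℂ_J` -/

section Regular

set_option linter.unusedSectionVars false

variable {A : Type*} [NormedSpaceNonAssocRing A] [NormedSpace ℝ A]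

/-- The stem identity extends by density and continuity, which makes `f` computable from `F` at
boundary points. -/
theorem IsStem.closure {D : Set ℂ} {F : ℂ → Complexification A} (h : IsStem D F)
    (hD : ∀ z ∈ D, conj z ∈ D) (hc : ContinuousOn F (closure D)) : IsStem (closure D) F := by
  have h1 : MapsTo conj (_root_.closure D) (_root_.closure D) := fun z hz =>
    map_mem_closure Complex.continuous_conj hz hD
  have h2 : EqOn (fun z => F (conj z)) (fun z => conjugateCLM (F z)) D := fun z hz => h z hz
  exact fun z hz => h2.of_subset_closure (hc.comp Complex.continuous_conj.continuousOn h1)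
    ((conjugateCLM (A := A)).continuous.comp_continuousOn hc) subset_closure subset_rfl hz

theorem IsStem.fderiv_conj {D : Set ℂ} {F : ℂ → Complexification A} (h : IsStem D F)
    (hDo : IsOpen D) (hD : ∀ z ∈ D, conj z ∈ D) (hd : ∀ z ∈ D, DifferentiableAt ℝ F z) {z : ℂ}
    (hz : z ∈ D) (v : ℂ) :
    fderiv ℝ F (conj z) (conj v) = Complexification.conjugate (fderiv ℝ F z v) := by
  have h1 : HasFDerivAt (fun w => F (conj w))
      ((fderiv ℝ F (conj z)).comp (Complex.conjCLE : ℂ →L[ℝ] ℂ)) z :=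
    HasFDerivAt.comp z (g := F) (hd _ (hD z hz)).hasFDerivAt Complex.conjCLE.hasFDerivAt
  have h2 : HasFDerivAt (fun w => F (conj w)) (conjugateCLM.comp (fderiv ℝ F z)) z := by
    refine (conjugateCLM.hasFDerivAt.comp z (hd z hz).hasFDerivAt).congr_of_eventuallyEq ?_
    filter_upwards [hDo.mem_nhds hz] with w hw
    exact h w hw
  exact DFunLike.congr_fun (h1.unique h2) v

theorem fstPart_dbar (F : ℂ → Complexification A) (z : ℂ) :
    Complexification.fstPart (dbar F z) = (1 / 2 : ℝ) •
      (Complexification.fstPart (fderiv ℝ F z 1) -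
        Complexification.sndPart (fderiv ℝ F z Complex.I)) := by
  change (1 / 2 : ℝ) • ((fderiv ℝ F z 1).1 + ((fderiv ℝ F z Complex.I).1 * 0 -
    (fderiv ℝ F z Complex.I).2 * 1)) = _
  rw [mul_zero, mul_one, zero_sub, ← sub_eq_add_neg]
  rfl

theorem sndPart_dbar (F : ℂ → Complexification A) (z : ℂ) :
    Complexification.sndPart (dbar F z) = (1 / 2 : ℝ) •
      (Complexification.sndPart (fderiv ℝ F z 1) +
        Complexification.fstPart (fderiv ℝ F z Complex.I)) := by
  change (1 / 2 : ℝ) • ((fderiv ℝ F z 1).2 + ((fderiv ℝ F z Complex.I).1 * 1 +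
    (fderiv ℝ F z Complex.I).2 * 0)) = _
  rw [mul_zero, mul_one, add_zero]
  rfl

/-- Needed to evaluate `𝓘(∂F/∂z̄)` with the chosen unit `J`, whatever representation `sliceFunction`
picks. -/
theorem IsStem.dbar {D : Set ℂ} {F : ℂ → Complexification A} (h : IsStem D F)
    (hDo : IsOpen D) (hD : ∀ z ∈ D, conj z ∈ D) (hd : ∀ z ∈ D, DifferentiableAt ℝ F z) :
    IsStem D (dbar F) := by
  intro z hz
  have h1 := h.fderiv_conj hDo hD hd hz 1
  have hI := h.fderiv_conj hDo hD hd hz Complex.I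
  rw [map_one] at h1
  rw [Complex.conj_I, map_neg, neg_eq_iff_eq_neg] at hI
  refine Complexification.ext_parts ?_ ?_
  · change _ = Complexification.fstPart (SliceRegular.dbar F z)
    rw [fstPart_dbar, fstPart_dbar, h1, hI]
    change _ • ((fderiv ℝ F z 1).1 - -(-(fderiv ℝ F z Complex.I).2)) = _
    rw [neg_neg]
    rfl
  · change _ = -Complexification.sndPart (SliceRegular.dbar F z)
    rw [sndPart_dbar, sndPart_dbar, h1, hI, ← smul_neg]
    change _ • (-(fderiv ℝ F z 1).2 + -((fderiv ℝ F z Complex.I).1)) = _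
    rw [← neg_add]
    rfl

variable [IsScalarTower ℝ A A] [SMulCommClass ℝ A A] [FiniteDimensional ℝ A] [IsAlternative A]
  [StarRing A] [StarModule ℝ A] [Nontrivial A]

/-- On a plane `ℂ_J` a slice regular function is holomorphic for the complex structure given by the
left multiplication by `J`. -/
theorem differentiableOn_complexFunctional_sliceRestriction {D : Set ℂ} {F : ℂ → Complexification A}
    (h : IsStem D F) (hDo : IsOpen D) (hD : ∀ z ∈ D, conj z ∈ D) (hreg : IsSliceRegular D F)
    {J : A} (hJ : J ∈ imagUnits A) (l : A →L[ℝ] ℝ) :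
    DifferentiableOn ℂ (fun ζ => complexFunctional J l (sliceRestriction J F ζ)) D := by
  have hd : ∀ z ∈ D, DifferentiableAt ℝ F z := fun z hz =>
    (hreg.1.differentiableOn one_ne_zero).differentiableAt (hDo.mem_nhds hz)
  intro z hz
  refine DifferentiableAt.differentiableWithinAt ?_
  have hder : HasFDerivAt (fun ζ => complexFunctional J l (sliceRestriction J F ζ))
      ((complexFunctional J l).comp ((evalCLM J).comp (fderiv ℝ F z))) z :=
    (complexFunctional J l).hasFDerivAt.comp z
      ((evalCLM J).hasFDerivAt.comp z (hd z hz).hasFDerivAt)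
  refine differentiableAt_complex_iff_differentiableAt_real.2 ⟨hder.differentiableAt, ?_⟩
  rw [hder.fderiv]
  have h0 := hreg.2 (phi J z) ⟨z, hz, J, hJ, rfl⟩
  rw [sliceFunction_phi (h.dbar hDo hD hd) hz hJ, fstPart_dbar, sndPart_dbar] at h0
  change complexFunctional J l (evalCLM J (fderiv ℝ F z Complex.I)) =
    Complex.I • complexFunctional J l (evalCLM J (fderiv ℝ F z 1))
  -- The Cauchy–Riemann equation `∂_s(F₁ + J F₂) = J ∂_r(F₁ + J F₂)`, obtained by multiplying the
  -- regularity condition by `J` on the left and by `-2`.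
  have hcr : evalCLM J (fderiv ℝ F z Complex.I) =
      phi J Complex.I * evalCLM J (fderiv ℝ F z 1) := by
    rw [evalCLM_apply, evalCLM_apply, phi_mul, mul_add, mul_mul_of_mem hJ]
    have h2 := congrArg (fun u => J * u) h0
    simp only [mul_add, mul_sub, mul_smul_comm, mul_mul_of_mem hJ, mul_zero] at h2
    rw [Complex.I_re, Complex.I_im, ← sub_eq_zero]
    refine Eq.trans ?_ ((congrArg (fun u => (-2 : ℝ) • u) h2).trans (smul_zero _))
    module
  rw [hcr, complexFunctional_phi_mul hJ, smul_eq_mul]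

theorem IsBoundaryCycle.intervalIntegrable_phi_mul {D : Set ℂ} {m : ℕ} {γ : Fin m → ℝ → ℂ}
    {a b : Fin m → ℝ} {C : ℝ≥0} (h : IsBoundaryCycle D γ a b C) (hDo : IsOpen D) (J : A)
    {B : ℂ → A} (hB : ContinuousOn B (_root_.closure D)) {z : ℂ} (hz : z ∈ D) (k : Fin m) :
    IntervalIntegrable
      (fun t => phi J ((γ k t - z)⁻¹ * (-Complex.I * deriv (γ k) t)) * B (γ k t))
      volume (a k) (b k) := by
  have hk : IntervalIntegrable (fun t => (γ k t - z)⁻¹ * (-Complex.I * deriv (γ k) t))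
      volume (a k) (b k) := by
    refine (h.intervalIntegrable_inv_mul_deriv hDo (g := fun _ => -Complex.I)
      continuousOn_const hz k).congr fun t _ => ?_
    ring
  have hBγ : ContinuousOn (fun t => B (γ k t)) (uIcc (a k) (b k)) := by
    rw [uIcc_of_le (h.lt k).le]
    exact hB.comp (h.lipschitz k).continuousOn fun t ht =>
      frontier_subset_closure (h.mem_frontier ht)
  have hre : IntervalIntegrable
      (fun t => ((γ k t - z)⁻¹ * (-Complex.I * deriv (γ k) t)).re) volume (a k) (b k) :=
    ⟨hk.1.re, hk.2.re⟩
  have him : IntervalIntegrable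
      (fun t => ((γ k t - z)⁻¹ * (-Complex.I * deriv (γ k) t)).im) volume (a k) (b k) :=
    ⟨hk.1.im, hk.2.im⟩
  simp only [phi_mul]
  exact (hre.smul_continuousOn hBγ).add
    (him.smul_continuousOn ((mulLeftCLM J).continuous.comp_continuousOn hBγ))

/-- Cauchy's formula on the plane `ℂ_J`. -/
theorem IsBoundaryCycle.sum_integral_phi_mul {D : Set ℂ} {m : ℕ} {γ : Fin m → ℝ → ℂ}
    {a b : Fin m → ℝ} {C : ℝ≥0} (h : IsBoundaryCycle D γ a b C) (hDo : IsOpen D)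
    (hDb : Bornology.IsBounded D) {J : A} (hJ : J ∈ imagUnits A) {B : ℂ → A}
    (hB : ContinuousOn B (_root_.closure D))
    (hd : ∀ l : A →L[ℝ] ℝ, DifferentiableOn ℂ (fun ζ => complexFunctional J l (B ζ)) D)
    {z : ℂ} (hz : z ∈ D) :
    ∑ k, ∫ t in (a k)..(b k),
      phi J ((γ k t - z)⁻¹ * (-Complex.I * deriv (γ k) t)) * B (γ k t) =
        (2 * Real.pi) • B z := by
  -- Real functionals separate points, and each is the real part of the complex functional to which
  -- the scalar formula applies.
  refine (SeparatingDual.eq_iff_forall_dual_eq (R := ℝ)).2 fun l => ?_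
  rw [← re_complexFunctional J l, ← re_complexFunctional J l]
  congr 1
  -- The factor `-i` comes from `J⁻¹ = -J`; it cancels the `i` of `2πi`.
  have h1 := h.sum_integral_inv_mul hDo hDb
    (g := fun ζ => -Complex.I * complexFunctional J l (B ζ))
    (continuousOn_const.mul ((complexFunctional J l).continuous.comp_continuousOn hB))
    ((hd l).const_mul _) hz
  rw [map_sum, map_smul, Complex.real_smul]
  calc ∑ k, complexFunctional J l (∫ t in (a k)..(b k),
        phi J ((γ k t - z)⁻¹ * (-Complex.I * deriv (γ k) t)) * B (γ k t))
      = ∑ k, ∫ t in (a k)..(b k),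
        (γ k t - z)⁻¹ * (-Complex.I * complexFunctional J l (B (γ k t))) * deriv (γ k) t := by
        refine Finset.sum_congr rfl fun k _ => ?_
        rw [← ContinuousLinearMap.intervalIntegral_comp_comm _
          (h.intervalIntegrable_phi_mul hDo J hB hz k)]
        congr 1 with t
        rw [complexFunctional_phi_mul hJ]
        ring
    _ = 2 * Real.pi * Complex.I * (-Complex.I * complexFunctional J l (B z)) := h1
    _ = _ := by
        rw [mul_assoc, ← mul_assoc Complex.I, mul_neg, Complex.I_mul_I, neg_neg, one_mul]
        push_cast
        rfl

/-- Almost everywhere along a boundary curve, the integrand of Cauchy's formula is a combination of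
the integrands of Cauchy's formula on `ℂ_J` at `z` and at its conjugate. -/
theorem IsBoundaryCycle.ae_cauchyIntegrand_eq {D : Set ℂ} {m : ℕ} {γ : Fin m → ℝ → ℂ}
    {a b : Fin m → ℝ} {C : ℝ≥0} (h : IsBoundaryCycle D γ a b C) (hDo : IsOpen D)
    (hD : ∀ z ∈ D, conj z ∈ D) {J K : A} (hJ : J ∈ imagUnits A) (hK : K ∈ imagUnits A)
    {B : ℂ → A} {f : A → A} (hf : ∀ ζ ∈ _root_.closure D, f (phi J ζ) = B ζ) {z : ℂ} (hz : z ∈ D)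
    (k : Fin m) :
    ∀ᵐ t ∂volume.restrict (Ioc (a k) (b k)),
      cauchyIntegrand J f (fun t => phi J (γ k t)) (phi K z) t =
        (1 / 2 : ℝ) • (phi J ((γ k t - z)⁻¹ * (-Complex.I * deriv (γ k) t)) * B (γ k t) +
            phi J ((γ k t - conj z)⁻¹ * (-Complex.I * deriv (γ k) t)) * B (γ k t)) +
          K * (J * ((1 / 2 : ℝ) •
            (phi J ((γ k t - conj z)⁻¹ * (-Complex.I * deriv (γ k) t)) * B (γ k t) -
              phi J ((γ k t - z)⁻¹ * (-Complex.I * deriv (γ k) t)) * B (γ k t)))) := by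
  -- Lipschitz curves are differentiable almost everywhere; at interior parameters this gives the
  -- two-sided derivative, which commutes with `φ_J`.
  have hdiff := ae_restrict_of_ae_restrict_of_subset Ioc_subset_Icc_self
    ((h.lipschitz k).ae_differentiableWithinAt_real measurableSet_Icc)
  filter_upwards [hdiff, ae_mem_Ioo k] with t ht1 ht2
  have ht3 : DifferentiableAt ℝ (γ k) t := ht1.differentiableAt (Icc_mem_nhds ht2.1 ht2.2)
  have hfr := h.mem_frontier (Ioo_subset_Icc_self ht2)
  have hder : deriv (fun t => phi J (γ k t)) t = phi J (deriv (γ k) t) :=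
    ((phiCLM J).hasFDerivAt.comp_hasDerivAt t ht3.hasDerivAt).deriv
  have hne : ∀ w ∈ D, γ k t ≠ w := fun w hw h' =>
    (disjoint_frontier_iff_isOpen.2 hDo).ne_of_mem hfr hw h'
  rw [cauchyIntegrand, hder, coneInv_mul_phi hJ, hf _ (frontier_subset_closure hfr)]
  exact cauchyKernelMulConst_phi_phi hJ hK (hne z hz) (hne _ (hD z hz)) _ _

end Regular

end SliceRegular

/-! ### Assembling the formula off the plane `ℂ_J` -/

theorem corollary3p6 {A : Type*} [NormedSpaceNonAssocRing A] [NormedSpace ℝ A]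
    [IsScalarTower ℝ A A] [SMulCommClass ℝ A A] [FiniteDimensional ℝ A] [IsAlternative A]
    [StarRing A] [StarModule ℝ A] (hdim : 1 < Module.finrank ℝ A)
    (D : Set ℂ) (hD_open : IsOpen D) (hD_bdd : Bornology.IsBounded D)
    (hD_conj : ∀ z ∈ D, conj z ∈ D)
    (J : A) (hJ : J ∈ imagUnits A)
    {m : ℕ} (γ : Fin m → ℝ → ℂ) (a b : Fin m → ℝ) (hγ : IsOrientedBoundary J D γ a b)
    (F : ℂ → Complexification A) (hF_stem : IsStem D F) (hF_C1 : IsC1OnClosure D F)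
    (f : A → A) (hf : ∀ x ∈ circularSet A (closure D), f x = sliceFunction F x)
    (hreg : IsSliceRegular D F) :
    ∀ x ∈ circularSet A D,
      (∀ k, IntervalIntegrable (cauchyIntegrand J f (fun t => phi J (γ k t)) x)
        MeasureTheory.volume (a k) (b k)) ∧
      f x = (1 / (2 * Real.pi)) •
        ∑ k, ∫ t in (a k)..(b k), cauchyIntegrand J f (fun t => phi J (γ k t)) x t := by
  have : Nontrivial A := Module.nontrivial_of_finrank_pos (zero_lt_one.trans hdim)
  rintro _ ⟨z, hz, K, hK, rfl⟩
  obtain ⟨C, h⟩ := hγ.exists_isBoundaryCycle hJ hD_conj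
  have hst := hF_stem.closure hD_conj hF_C1.1
  have hB : ContinuousOn (sliceRestriction J F) (closure D) :=
    (evalCLM J).continuous.comp_continuousOn hF_C1.1
  have hfB : ∀ ζ ∈ closure D, f (phi J ζ) = sliceRestriction J F ζ := fun ζ hζ => by
    rw [hf _ ⟨ζ, hζ, J, hJ, rfl⟩, sliceFunction_phi hst hζ hJ, sliceRestriction]
  have hd := differentiableOn_complexFunctional_sliceRestriction hF_stem hD_open hD_conj hreg hJ
  have hz' := hD_conj z hz
  set V : Fin m → ℝ → A := fun k t =>
    phi J ((γ k t - z)⁻¹ * (-Complex.I * deriv (γ k) t)) * sliceRestriction J F (γ k t)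
  set W : Fin m → ℝ → A := fun k t =>
    phi J ((γ k t - conj z)⁻¹ * (-Complex.I * deriv (γ k) t)) * sliceRestriction J F (γ k t)
  have hVi : ∀ k, IntervalIntegrable (V k) MeasureTheory.volume (a k) (b k) :=
    h.intervalIntegrable_phi_mul hD_open J hB hz
  have hWi : ∀ k, IntervalIntegrable (W k) MeasureTheory.volume (a k) (b k) :=
    h.intervalIntegrable_phi_mul hD_open J hB hz'
  have hVs : ∑ k, ∫ t in (a k)..(b k), V k t = (2 * Real.pi) • sliceRestriction J F z :=
    h.sum_integral_phi_mul hD_open hD_bdd hJ hB hd hz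
  have hWs : ∑ k, ∫ t in (a k)..(b k), W k t = (2 * Real.pi) • sliceRestriction J F (conj z) :=
    h.sum_integral_phi_mul hD_open hD_bdd hJ hB hd hz'
  -- Packaging `u ↦ K(J(½u))` as a continuous linear map lets it pass through the integral.
  let T : A →L[ℝ] A := (mulLeftCLM K).comp ((mulLeftCLM J).comp
    ((1 / 2 : ℝ) • ContinuousLinearMap.id ℝ A))
  have hae : ∀ k, ∀ᵐ t ∂MeasureTheory.volume.restrict (Set.uIoc (a k) (b k)),
      ((1 / 2 : ℝ) • (V k t + W k t) + T (W k t - V k t)) =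
        cauchyIntegrand J f (fun t => phi J (γ k t)) (phi K z) t := fun k => by
    rw [Set.uIoc_of_le (h.lt k).le]
    exact (h.ae_cauchyIntegrand_eq hD_open hD_conj hJ hK hfB hz k).mono fun t ht => ht.symm
  have hTi : ∀ k, IntervalIntegrable (fun t => T (W k t - V k t)) MeasureTheory.volume (a k) (b k) :=
    fun k => ⟨T.integrable_comp ((hWi k).sub (hVi k)).1, T.integrable_comp ((hWi k).sub (hVi k)).2⟩
  have hSi : ∀ k, IntervalIntegrable (fun t => (1 / 2 : ℝ) • (V k t + W k t))
      MeasureTheory.volume (a k) (b k) := fun k => ((hVi k).add (hWi k)).smul _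
  refine ⟨fun k => ((hSi k).add (hTi k)).congr_ae (hae k), ?_⟩
  have hI : ∀ k, ∫ t in (a k)..(b k), cauchyIntegrand J f (fun t => phi J (γ k t)) (phi K z) t =
      (1 / 2 : ℝ) • ((∫ t in (a k)..(b k), V k t) + ∫ t in (a k)..(b k), W k t) +
        T ((∫ t in (a k)..(b k), W k t) - ∫ t in (a k)..(b k), V k t) := fun k => by
    rw [← intervalIntegral.integral_congr_ae_restrict (hae k),
      intervalIntegral.integral_add (hSi k) (hTi k), intervalIntegral.integral_smul,
      intervalIntegral.integral_add (hVi k) (hWi k),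
      T.intervalIntegral_comp_comm ((hWi k).sub (hVi k)),
      intervalIntegral.integral_sub (hWi k) (hVi k)]
  simp only [hI]
  rw [Finset.sum_add_distrib, ← Finset.smul_sum, ← map_sum, Finset.sum_add_distrib,
    Finset.sum_sub_distrib, hVs, hWs, hf _ ⟨z, subset_closure hz, K, hK, rfl⟩,
    sliceFunction_phi hF_stem hz hK, ← smul_add, ← smul_sub, map_smul, smul_comm (1 / 2 : ℝ),
    ← smul_add, smul_smul, one_div_mul_cancel Real.two_pi_pos.ne', one_smul]
  -- Conjugating `z` flips the sign of `F₂`: the values at `z` and `z̄` on `ℂ_J` determine `F₁(z)`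
  -- and `J F₂(z)`, hence the value at `φ_K(z)` for every `K`.
  have hc : sliceRestriction J F (conj z) =
      Complexification.fstPart (F z) - J * Complexification.sndPart (F z) := by
    rw [sliceRestriction, hF_stem z hz]
    change _ + J * -Complexification.sndPart (F z) = _
    rw [mul_neg, ← sub_eq_add_neg]
    rfl
  rw [hc, sliceRestriction]
  generalize Complexification.fstPart (F z) = u
  generalize Complexification.sndPart (F z) = v
  have h1 : (1 / 2 : ℝ) • (u + J * v + (u - J * v)) = u := by module
  have h2 : T (u - J * v - (u + J * v)) = K * v := by
    change K * (J * ((1 / 2 : ℝ) • (u - J * v - (u + J * v)))) = K * v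
    have : (1 / 2 : ℝ) • (u - J * v - (u + J * v)) = -(J * v) := by module
    rw [this, mul_neg, mul_mul_of_mem hJ, neg_neg]
  rw [h1, h2]
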